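/- Let $d\in\mathbb N$, $n\in\mathbb N_{\ge 1}$ and $0<\alpha<\beta\le 1$, and let $I=[0,1]$ carry Lebesgue measure. For $\gamma\in(0,1]$ let $C^{n,\gamma}_0(\mathbb R^d,\mathbb R^d)$ be the Banach space of all $C^n$-maps $f:\mathbb R^d\to\mathbb R^d$ with $$\|f\|_{n,\gamma}:=\max\Big\{\sup_{0\le l\le n,\;x\in\mathbb R^d}\|f^{(l)}(x)\|,\ \sup_{x\neq y}\frac{\|f^{(n)}(x)-f^{(n)}(y)\|}{\|x-y\|^{\gamma}}\Big\}<\infty$$ (operator norms of multilinear maps) such that $\|f^{(l)}(x)\|\to 0$ as $\|x\|\to\infty$ for all $0\le l\le n$. Let $$\mathcal D^{n,\alpha}(\mathbb R^d):=\big\{\Phi\in \mathrm{Id}+C^{n,\alpha}_0(\mathbb R^d,\mathbb R^d):\ \det d\Phi(x)>0\ \text{ for all } x\in\mathbb R^d\big\},$$ with the topology induced by $\Phi\mapsto\Phi-\mathrm{Id}\in C^{n,\alpha}_0(\mathbb R^d,\mathbb R^d)$. Let $u:I\to C^{n,\beta}_0(\mathbb R^d,\mathbb R^d)$ be Bochner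 integrable. Then $u$ has a unique strong $\mathcal D^{n,\alpha}$-flow: there is exactly one map $\Phi:I\to\mathcal D^{n,\alpha}(\mathbb R^d)$ such that $\Phi$ is continuous, $s\mapsto u(s)\circ\Phi(s)$ takes values in $C^{n,\alpha}_0(\mathbb R^d,\mathbb R^d)$ and is Bochner integrable as a map into that space, and $$\Phi(t)=\mathrm{Id}+\int_0^t u(s)\circ\Phi(s)\,ds\qquad\text{for all } t\in[0,1],$$ where the integral is the Bochner integral in $C^{n,\alpha}_0(\mathbb R^d,\mathbb R^d)$. -/

import Mathlib

open Filter Topology MeasureTheory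
open scoped NNReal ENNReal unitInterval

section HolderSpace

/-- The (extended) Hölder norm
`max (sup_{l ≤ n, x} ‖f⁽ˡ⁾(x)‖) (sup_{x ≠ y} ‖f⁽ⁿ⁾(x) - f⁽ⁿ⁾(y)‖ / ‖x - y‖ ^ α)`. -/
noncomputable def holderENorm {E F : Type*} [NormedAddCommGroup E] [NormedSpace ℝ E]
    [NormedAddCommGroup F] [NormedSpace ℝ F] (n : ℕ) (α : ℝ≥0) (f : E → F) : ℝ≥0∞ :=
  max (⨆ (l : ℕ) (_ : l ≤ n) (x : E), ‖iteratedFDeriv ℝ l f x‖ₑ)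
    (eHolderNorm α (iteratedFDeriv ℝ n f))

/-- Membership in `C^{n,α}_0(E, F)`: the function is `C^n`, its Hölder norm is finite, and it tends
to `0` at infinity together with all its derivatives up to order `n`. -/
structure IsC0Holder {E F : Type*} [NormedAddCommGroup E] [NormedSpace ℝ E]
    [NormedAddCommGroup F] [NormedSpace ℝ F] (n : ℕ) (α : ℝ≥0) (f : E → F) : Prop where
  contDiff : ContDiff ℝ n f
  norm_lt_top : holderENorm n α f < ∞
  tendsto_zero : ∀ l : ℕ, l ≤ n → ∀ ε : ℝ, 0 < ε → ∃ r : ℝ, 0 < r ∧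
    ∀ x : E, r < ‖x‖ → ‖iteratedFDeriv ℝ l f x‖ ≤ ε

variable {E F : Type*} [NormedAddCommGroup E] [NormedSpace ℝ E]
  [NormedAddCommGroup F] [NormedSpace ℝ F]

lemma enorm_iteratedFDeriv_le_holderENorm {n : ℕ} {α : ℝ≥0} (f : E → F) {l : ℕ} (hl : l ≤ n)
    (x : E) : ‖iteratedFDeriv ℝ l f x‖ₑ ≤ holderENorm n α f :=
  le_max_of_le_left (le_iSup_of_le l (le_iSup_of_le hl (le_iSup_of_le x le_rfl)))

lemma holderENorm_zero (n : ℕ) (α : ℝ≥0) : holderENorm n α (0 : E → F) = 0 := by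
  have h : ∀ l : ℕ, iteratedFDeriv ℝ l (0 : E → F) = 0 := fun l => iteratedFDeriv_fun_zero
  have h0 : ∀ (l : ℕ) (x : E), ‖iteratedFDeriv ℝ l (0 : E → F) x‖ₑ = 0 := fun l x => by
    rw [h l, Pi.zero_apply, ← ofReal_norm, norm_zero, ENNReal.ofReal_zero]
  rw [holderENorm, h n, eHolderNorm_zero]
  simp only [h0]
  simp

lemma holderENorm_add_le {n : ℕ} {α : ℝ≥0} {f g : E → F} (hf : ContDiff ℝ n f)
    (hg : ContDiff ℝ n g) :
    holderENorm n α (f + g) ≤ holderENorm n α f + holderENorm n α g := by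
  have h : ∀ l : ℕ, l ≤ n →
      iteratedFDeriv ℝ l (f + g) = iteratedFDeriv ℝ l f + iteratedFDeriv ℝ l g := fun l hl =>
    iteratedFDeriv_add (hf.of_le (by exact_mod_cast hl)) (hg.of_le (by exact_mod_cast hl))
  refine max_le (iSup_le fun l => iSup_le fun hl => iSup_le fun x => ?_) ?_
  · rw [h l hl]
    have h1 := enorm_iteratedFDeriv_le_holderENorm (α := α) f hl x
    have h2 := enorm_iteratedFDeriv_le_holderENorm (α := α) g hl x
    refine le_trans ?_ (add_le_add h1 h2)
    rw [← ofReal_norm, ← ofReal_norm, ← ofReal_norm,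
      ← ENNReal.ofReal_add (norm_nonneg _) (norm_nonneg _)]
    exact ENNReal.ofReal_le_ofReal (norm_add_le _ _)
  · rw [h n le_rfl]
    exact eHolderNorm_add_le.trans (add_le_add (le_max_right _ _) (le_max_right _ _))

lemma eHolderNorm_real_smul {X Y : Type*} [MetricSpace X] [NormedAddCommGroup Y] [NormedSpace ℝ Y]
    (α : ℝ≥0) (c : ℝ) (f : X → Y) :
    eHolderNorm α (fun x => c • f x) = ‖c‖ₑ * eHolderNorm α f := eHolderNorm_smul c

lemma holderENorm_smul {n : ℕ} {α : ℝ≥0} {f : E → F} (c : ℝ) (hf : ContDiff ℝ n f) :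
    holderENorm n α (c • f) = ‖c‖ₑ * holderENorm n α f := by
  have h : ∀ l : ℕ, l ≤ n → iteratedFDeriv ℝ l (c • f) = c • iteratedFDeriv ℝ l f :=
    fun l hl => funext fun x => iteratedFDeriv_const_smul_apply
      (hf.of_le (by exact_mod_cast hl)).contDiffAt
  have hmax : ∀ a b c : ℝ≥0∞, c * max a b = max (c * a) (c * b) := fun a b c =>
    Monotone.map_max (f := fun z => c * z) fun _ _ h => mul_le_mul_right h c
  have hs : eHolderNorm α (iteratedFDeriv ℝ n (c • f)) =
      ‖c‖ₑ * eHolderNorm α (iteratedFDeriv ℝ n f) := by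
    have key : ∀ g : E → E [×n]→L[ℝ] F,
        eHolderNorm α (fun x => c • g x) = ‖c‖ₑ * eHolderNorm α g := fun g =>
      eHolderNorm_real_smul α c g
    rw [h n le_rfl]
    exact key _
  rw [holderENorm, hs, holderENorm, hmax]
  congr 1
  simp only [ENNReal.mul_iSup]
  refine iSup_congr fun l => iSup_congr fun hl => iSup_congr fun x => ?_
  rw [h l hl, Pi.smul_apply, enorm_smul]

/-- `C^{n,α}_0(E, F)` as a linear subspace of the space of all functions `E → F`. -/
def c0HolderSubmodule (n : ℕ) (α : ℝ≥0) (E F : Type*) [NormedAddCommGroup E] [NormedSpace ℝ E]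
    [NormedAddCommGroup F] [NormedSpace ℝ F] : Submodule ℝ (E → F) where
  carrier := {f | IsC0Holder n α f}
  zero_mem' := by
    refine ⟨contDiff_const, ?_, fun l _ ε hε => ⟨1, one_pos, fun x _ => ?_⟩⟩
    · rw [holderENorm_zero]; exact ENNReal.zero_lt_top
    · have h : iteratedFDeriv ℝ l (0 : E → F) = 0 := iteratedFDeriv_fun_zero
      simp [h, hε.le]
  add_mem' := by
    intro f g hf hg
    refine ⟨hf.1.add hg.1, (holderENorm_add_le hf.1 hg.1).trans_lt
      (ENNReal.add_lt_top.2 ⟨hf.2, hg.2⟩), fun l hl ε hε => ?_⟩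
    obtain ⟨r, hr, h1⟩ := hf.3 l hl (ε / 2) (by positivity)
    obtain ⟨s, hs, h2⟩ := hg.3 l hl (ε / 2) (by positivity)
    refine ⟨max r s, lt_max_of_lt_left hr, fun x hx => ?_⟩
    rw [iteratedFDeriv_add (hf.1.of_le (by exact_mod_cast hl))
      (hg.1.of_le (by exact_mod_cast hl)), Pi.add_apply]
    have := h1 x ((le_max_left _ _).trans_lt hx)
    have := h2 x ((le_max_right _ _).trans_lt hx)
    exact (norm_add_le _ _).trans (by linarith)
  smul_mem' := by
    intro c f hf
    refine ⟨contDiff_const.smul hf.1, ?_, fun l hl ε hε => ?_⟩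
    · rw [holderENorm_smul c hf.1]
      exact ENNReal.mul_lt_top enorm_lt_top hf.2
    · obtain ⟨r, hr, h⟩ := hf.3 l hl (ε / (‖c‖ + 1)) (by positivity)
      refine ⟨r, hr, fun x hx => ?_⟩
      rw [iteratedFDeriv_const_smul_apply (hf.1.of_le (by exact_mod_cast hl)).contDiffAt,
        norm_smul]
      have h1 := h x hx
      rw [le_div_iff₀ (by positivity)] at h1
      nlinarith [norm_nonneg (iteratedFDeriv ℝ l f x), norm_nonneg c]

/-- The Hölder space `C^{n,α}_0(E, F)`, as a type of its own: its topology is the one of the Hölder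
norm, not the one of pointwise convergence. -/
def C0Holder (n : ℕ) (α : ℝ≥0) (E F : Type*) [NormedAddCommGroup E] [NormedSpace ℝ E]
    [NormedAddCommGroup F] [NormedSpace ℝ F] : Type _ :=
  c0HolderSubmodule n α E F

namespace C0Holder

variable {n : ℕ} {α : ℝ≥0}

/-- The element of `C^{n,α}_0(E, F)` given by a function. -/
def mk (f : E → F) (hf : IsC0Holder n α f) : C0Holder n α E F := ⟨f, hf⟩

/-- The underlying function. -/
def toFun (f : C0Holder n α E F) : E → F := f.1

instance : CoeFun (C0Holder n α E F) (fun _ => E → F) := ⟨toFun⟩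

noncomputable instance : AddCommGroup (C0Holder n α E F) :=
  inferInstanceAs (AddCommGroup (c0HolderSubmodule n α E F))

noncomputable instance : Module ℝ (C0Holder n α E F) :=
  inferInstanceAs (Module ℝ (c0HolderSubmodule n α E F))

noncomputable instance : Norm (C0Holder n α E F) := ⟨fun f => (holderENorm n α f).toReal⟩

lemma isC0Holder (f : C0Holder n α E F) : IsC0Holder n α f := f.2

lemma norm_def (f : C0Holder n α E F) : ‖f‖ = (holderENorm n α f).toReal := rfl

@[ext] lemma ext {f g : C0Holder n α E F} (h : ∀ x, f x = g x) : f = g := Subtype.ext (funext h)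

@[simp] lemma mk_apply (f : E → F) (hf : IsC0Holder n α f) (x : E) : mk f hf x = f x := rfl

@[simp] lemma add_apply (f g : C0Holder n α E F) (x : E) : (f + g) x = f x + g x := rfl

@[simp] lemma zero_apply (x : E) : (0 : C0Holder n α E F) x = 0 := rfl

@[simp] lemma neg_apply (f : C0Holder n α E F) (x : E) : (-f) x = -f x := rfl

@[simp] lemma sub_apply (f g : C0Holder n α E F) (x : E) : (f - g) x = f x - g x := by
  rw [sub_eq_add_neg, sub_eq_add_neg]; rfl

@[simp] lemma smul_apply (c : ℝ) (f : C0Holder n α E F) (x : E) : (c • f) x = c • f x := rfl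

lemma norm_iteratedFDeriv_le (f : C0Holder n α E F) {l : ℕ} (hl : l ≤ n) (x : E) :
    ‖iteratedFDeriv ℝ l f x‖ ≤ ‖f‖ := by
  have h := ENNReal.toReal_mono f.isC0Holder.norm_lt_top.ne
    (enorm_iteratedFDeriv_le_holderENorm (α := α) (f : E → F) hl x)
  rwa [toReal_enorm] at h

lemma norm_apply_le (f : C0Holder n α E F) (x : E) : ‖f x‖ ≤ ‖f‖ := by
  simpa using f.norm_iteratedFDeriv_le (Nat.zero_le n) x

lemma normCore : NormedSpace.Core ℝ (C0Holder n α E F) where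
  norm_nonneg _ := ENNReal.toReal_nonneg
  norm_smul c f := by
    change (holderENorm n α (c • (f : E → F))).toReal = ‖c‖ * (holderENorm n α f).toReal
    rw [holderENorm_smul c f.isC0Holder.contDiff, ENNReal.toReal_mul, toReal_enorm]
  norm_triangle f g := by
    change (holderENorm n α ((f : E → F) + (g : E → F))).toReal ≤ _
    refine (ENNReal.toReal_mono ?_ (holderENorm_add_le f.isC0Holder.contDiff
      g.isC0Holder.contDiff)).trans_eq (ENNReal.toReal_add f.isC0Holder.norm_lt_top.ne
      g.isC0Holder.norm_lt_top.ne)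
    exact (ENNReal.add_lt_top.2 ⟨f.isC0Holder.norm_lt_top, g.isC0Holder.norm_lt_top⟩).ne
  norm_eq_zero_iff f := by
    constructor
    · intro h
      ext x
      simpa [h] using f.norm_apply_le x
    · rintro rfl
      change (holderENorm n α (0 : E → F)).toReal = 0
      rw [holderENorm_zero, ENNReal.toReal_zero]

noncomputable instance : NormedAddCommGroup (C0Holder n α E F) := NormedAddCommGroup.ofCore normCore

noncomputable instance : NormedSpace ℝ (C0Holder n α E F) := NormedSpace.ofCore normCore

lemma eHolderNorm_le (f : C0Holder n α E F) :
    eHolderNorm α (iteratedFDeriv ℝ n f) ≤ ENNReal.ofReal ‖f‖ := by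
  rw [norm_def, ENNReal.ofReal_toReal f.isC0Holder.norm_lt_top.ne]
  exact le_max_right _ _

lemma norm_iteratedFDeriv_sub_le (f : C0Holder n α E F) (x y : E) :
    ‖iteratedFDeriv ℝ n f x - iteratedFDeriv ℝ n f y‖ ≤ ‖f‖ * dist x y ^ (α : ℝ) := by
  have hm : MemHolder α (iteratedFDeriv ℝ n f) :=
    eHolderNorm_lt_top.1 (f.eHolderNorm_le.trans_lt ENNReal.ofReal_lt_top)
  have h1 := hm.holderWith.dist_le x y
  rw [dist_eq_norm] at h1
  refine h1.trans (mul_le_mul_of_nonneg_right ?_ (by positivity))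
  exact ENNReal.toReal_le_of_le_ofReal (norm_nonneg f) f.eHolderNorm_le

section Series

variable [CompleteSpace F]

lemma iteratedFDeriv_tsum_apply (v : ℕ → C0Holder n α E F) (hv : Summable fun i => ‖v i‖) {l : ℕ}
    (hl : l ≤ n) (x : E) :
    iteratedFDeriv ℝ l (fun y => ∑' i, v i y) x = ∑' i, iteratedFDeriv ℝ l (v i) x := by
  refine _root_.iteratedFDeriv_tsum_apply (N := (n : ℕ∞)) (v := fun _ i => ‖v i‖)
    (fun i => (v i).isC0Holder.contDiff) (fun _ _ => hv) (fun k i x hk => ?_) ?_ x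
  · exact (v i).norm_iteratedFDeriv_le (by exact_mod_cast hk) x
  · exact_mod_cast hl

lemma holderENorm_tsum_le (v : ℕ → C0Holder n α E F) (hv : Summable fun i => ‖v i‖) :
    holderENorm n α (fun y => ∑' i, v i y) ≤ ENNReal.ofReal (∑' i, ‖v i‖) := by
  refine max_le (iSup_le fun l => iSup_le fun hl => iSup_le fun x => ?_) ?_
  · rw [← ofReal_norm, iteratedFDeriv_tsum_apply v hv hl]
    exact ENNReal.ofReal_le_ofReal
      (tsum_of_norm_bounded hv.hasSum fun i => (v i).norm_iteratedFDeriv_le hl x)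
  · refine HolderWith.eHolderNorm_le (C := (∑' i, ‖v i‖).toNNReal) fun x y => ?_
    rw [iteratedFDeriv_tsum_apply v hv le_rfl, iteratedFDeriv_tsum_apply v hv le_rfl,
      edist_dist, edist_dist, ENNReal.ofReal_rpow_of_nonneg dist_nonneg α.coe_nonneg]
    change _ ≤ ENNReal.ofReal _ * _
    rw [← ENNReal.ofReal_mul (tsum_nonneg fun i => norm_nonneg _)]
    refine ENNReal.ofReal_le_ofReal ?_
    have hs : ∀ z : E, Summable fun i => iteratedFDeriv ℝ n (v i) z := fun z =>
      .of_norm_bounded hv fun i => (v i).norm_iteratedFDeriv_le le_rfl z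
    rw [dist_eq_norm, ← (hs x).tsum_sub (hs y)]
    exact tsum_of_norm_bounded (hv.hasSum.mul_right _)
      fun i => (v i).norm_iteratedFDeriv_sub_le x y

lemma isC0Holder_tsum (v : ℕ → C0Holder n α E F) (hv : Summable fun i => ‖v i‖) :
    IsC0Holder n α (fun y => ∑' i, v i y) := by
  refine ⟨?_, (holderENorm_tsum_le v hv).trans_lt ENNReal.ofReal_lt_top, fun l hl ε hε => ?_⟩
  · refine contDiff_tsum (N := (n : ℕ∞)) (v := fun _ i => ‖v i‖)
      (fun i => (v i).isC0Holder.contDiff) (fun _ _ => hv) (fun k i x hk => ?_)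
    exact (v i).norm_iteratedFDeriv_le (by exact_mod_cast hk) x
  · have h : Tendsto (fun x => ∑' i, iteratedFDeriv ℝ l (v i) x) (comap norm atTop)
        (𝓝 (∑' _ : ℕ, 0)) := by
      refine tendsto_tsum_of_dominated_convergence hv (fun i => ?_)
        (Eventually.of_forall fun x i => (v i).norm_iteratedFDeriv_le hl x)
      rw [Metric.tendsto_nhds]
      intro δ hδ
      obtain ⟨r, _, hr⟩ := (v i).isC0Holder.tendsto_zero l hl (δ / 2) (by positivity)
      filter_upwards [(eventually_gt_atTop r).comap norm] with x hx
      rw [dist_zero_right]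
      linarith [hr x hx]
    rw [tsum_zero, Metric.tendsto_nhds] at h
    obtain ⟨s, hs, hsub⟩ := mem_comap.1 (h ε hε)
    obtain ⟨r, hr⟩ := mem_atTop_sets.1 hs
    refine ⟨max r 1, by positivity, fun x hx => ?_⟩
    rw [iteratedFDeriv_tsum_apply v hv hl]
    have := hsub (show x ∈ norm ⁻¹' s from hr _ ((le_max_left _ _).trans hx.le))
    simpa using (show dist _ _ < ε from this).le

end Series

/-- The Hölder spaces are Banach spaces, so that Bochner integrals in them make sense. -/
instance [CompleteSpace F] : CompleteSpace (C0Holder n α E F) := by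
  refine NormedAddCommGroup.completeSpace_of_summable_imp_tendsto fun u hu => ?_
  have hp : ∀ x, Summable fun i => u i x := fun x =>
    .of_norm_bounded hu fun i => (u i).norm_apply_le x
  refine ⟨mk _ (isC0Holder_tsum u hu), ?_⟩
  rw [tendsto_iff_norm_sub_tendsto_zero]
  refine squeeze_zero (fun _ => norm_nonneg _) (fun N => ?_) (tendsto_sum_nat_add fun i => ‖u i‖)
  have hN : Summable fun i => ‖u (i + N)‖ := (summable_nat_add_iff N).2 hu
  have hsum : ∀ x, (∑ i ∈ Finset.range N, u i) x = ∑ i ∈ Finset.range N, u i x := by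
    intro x
    induction N with
    | zero => simp
    | succ N ih => rw [Finset.sum_range_succ, Finset.sum_range_succ, add_apply,
        ih ((summable_nat_add_iff N).2 hu)]
  have he : mk _ (isC0Holder_tsum u hu) - ∑ i ∈ Finset.range N, u i =
      mk _ (isC0Holder_tsum (fun i => u (i + N)) hN) := by
    ext x
    rw [sub_apply, hsum, mk_apply, mk_apply, ← (hp x).sum_add_tsum_nat_add N, add_sub_cancel_left]
  rw [norm_sub_rev, he]
  exact ENNReal.toReal_le_of_le_ofReal (tsum_nonneg fun _ => norm_nonneg _)
    (holderENorm_tsum_le (fun i => u (i + N)) hN)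

end C0Holder

end HolderSpace

section Flow

/-- `𝒟^{n,α}(ℝᵈ)`: the maps `Φ ∈ Id + C^{n,α}_0(ℝᵈ, ℝᵈ)` with `det dΦ(x) > 0` for all `x`. -/
structure HolderDiffeo (n : ℕ) (α : ℝ≥0) (d : ℕ) where
  toFun : EuclideanSpace ℝ (Fin d) → EuclideanSpace ℝ (Fin d)
  isC0Holder_sub_id : IsC0Holder n α (fun x => toFun x - x)
  det_pos : ∀ x, 0 < (fderiv ℝ toFun x).det

namespace HolderDiffeo

variable {n : ℕ} {α : ℝ≥0} {d : ℕ}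

instance : CoeFun (HolderDiffeo n α d)
    (fun _ => EuclideanSpace ℝ (Fin d) → EuclideanSpace ℝ (Fin d)) := ⟨fun Φ => Φ.toFun⟩

/-- The global chart `Φ ↦ Φ - Id` of `𝒟^{n,α}(ℝᵈ)`. -/
noncomputable def subId (Φ : HolderDiffeo n α d) :
    C0Holder n α (EuclideanSpace ℝ (Fin d)) (EuclideanSpace ℝ (Fin d)) :=
  C0Holder.mk (fun x => Φ x - x) Φ.isC0Holder_sub_id

/-- The topology of `𝒟^{n,α}(ℝᵈ)` as a subset of the affine space `Id + C^{n,α}_0(ℝᵈ, ℝᵈ)`. -/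
noncomputable instance : TopologicalSpace (HolderDiffeo n α d) := TopologicalSpace.induced subId inferInstance

end HolderDiffeo

/-- `Φ : [0,1] → 𝒟^{n,α}(ℝᵈ)` is a strong `𝒟^{n,α}`-flow of `u : [0,1] → C^{n,β}_0(ℝᵈ, ℝᵈ)`: it is
continuous, the map `s ↦ u(s) ∘ Φ(s)` takes values in `C^{n,α}_0(ℝᵈ, ℝᵈ)` and is Bochner integrable
there, and `Φ(t) = Id + ∫₀ᵗ u(s) ∘ Φ(s) ds` for all `t`, with the integral in `C^{n,α}_0(ℝᵈ, ℝᵈ)`. -/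
def IsStrongFlow {n : ℕ} {α β : ℝ≥0} {d : ℕ}
    (u : I → C0Holder n β (EuclideanSpace ℝ (Fin d)) (EuclideanSpace ℝ (Fin d)))
    (Φ : I → HolderDiffeo n α d) : Prop :=
  Continuous Φ ∧
  ∃ h : ∀ s : I, IsC0Holder n α (fun x => u s (Φ s x)),
    Integrable (fun s : I => C0Holder.mk (fun x => u s (Φ s x)) (h s)) ∧
    ∀ t : I, (Φ t).subId = ∫ s in Set.Iic t, C0Holder.mk (fun x => u s (Φ s x)) (h s)

end Flow

-- The equation is solved by Picard iteration for `φ = Φ - Id`. For `f` only of class `C^{n,β}`, the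
-- map `φ ↦ f ∘ (Id + φ)` need not be Lipschitz in a Hölder norm of order `n`, so a contraction in
-- `C^{n,α}_0` is not available. Two weaker facts replace it. Boundedness: for `φ` in a ball of
-- `C^{n,β}_0`, the operators `f ↦ f ∘ (Id + φ)` are uniformly bounded on `C^{n,β}_0`
-- (`comp_id_add`). Contraction: since `n ≥ 1`, `f ∘ (Id + φ)` is Lipschitz in `φ` for the sup norm,
-- with constant `‖f‖`. The lemma `interpolation` joins them: bounded in `C^{n,β}` and small in the
-- sup norm implies small in `C^{n,α}`.
--
-- It follows that composition is continuous on `C^{n,β}_0` times a `β`-ball carrying the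
-- `α`-topology (`tendsto_compRight_inclusion`), which makes the integrand Bochner measurable, and
-- that iterates which stay in a `β`-ball and contract uniformly converge in `C^{n,α}_0` to a flow
-- (`exists_isFlow_of_picard`).
--
-- If `∫ ‖u‖` is small, the ball of radius `1/2` is invariant, and `‖dφ‖ < 1` forces `det (Id + dφ)
-- > 0`. In general, time is cut repeatedly where half of the mass of `‖u‖` is used up, and the
-- flows of the pieces are composed (`IsFlow.concat`); determinants multiply by the chain rule.
--
-- Uniqueness is pointwise: for fixed `x`, two flows satisfy a Grönwall inequality with kernel
-- `‖u(s)‖`, which needs no `β`-bound on them (`IsFlow.eq`).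

universe w

/-- `f` is of class `C^n`, its derivatives up to order `n` are bounded by `C` and vanish at infinity,
and its `n`-th derivative is `γ`-Hölder with constant `C`. -/
structure HolderBounded {E F : Type*} [NormedAddCommGroup E] [NormedSpace ℝ E]
    [NormedAddCommGroup F] [NormedSpace ℝ F] (n : ℕ) (γ : ℝ≥0) (f : E → F) (C : ℝ) : Prop where
  contDiff : ContDiff ℝ n f
  bound : ∀ l ≤ n, ∀ x, ‖iteratedFDeriv ℝ l f x‖ ≤ C
  holder : ∀ x y, ‖iteratedFDeriv ℝ n f x - iteratedFDeriv ℝ n f y‖ ≤ C * dist x y ^ (γ : ℝ)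
  vanish : ∀ l ≤ n, Tendsto (iteratedFDeriv ℝ l f) (Bornology.cobounded E) (𝓝 0)

/-! ### Hölder bounds with explicit constants -/

namespace HolderBounded

section General

variable {E F : Type*} [NormedAddCommGroup E] [NormedSpace ℝ E]
  [NormedAddCommGroup F] [NormedSpace ℝ F] {n : ℕ} {α β γ : ℝ≥0} {f g : E → F} {A B C : ℝ}

lemma nonneg (h : HolderBounded n γ f C) : 0 ≤ C :=
  (norm_nonneg _).trans (h.bound 0 (Nat.zero_le _) 0)

lemma norm_le (h : HolderBounded n γ f C) (x : E) : ‖f x‖ ≤ C := by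
  simpa using h.bound 0 (Nat.zero_le _) x

lemma mono (h : HolderBounded n γ f A) (hAB : A ≤ B) : HolderBounded n γ f B where
  contDiff := h.contDiff
  bound l hl x := (h.bound l hl x).trans hAB
  holder x y := (h.holder x y).trans (by gcongr)
  vanish := h.vanish

lemma add (hf : HolderBounded n γ f A) (hg : HolderBounded n γ g B) :
    HolderBounded n γ (f + g) (A + B) := by
  have h : ∀ l ≤ n, iteratedFDeriv ℝ l (f + g) = iteratedFDeriv ℝ l f + iteratedFDeriv ℝ l g :=
    fun l hl => iteratedFDeriv_add (hf.contDiff.of_le (by exact_mod_cast hl))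
      (hg.contDiff.of_le (by exact_mod_cast hl))
  refine ⟨hf.contDiff.add hg.contDiff, fun l hl x => ?_, fun x y => ?_, fun l hl => ?_⟩
  · rw [h l hl]
    exact norm_add_le_of_le (hf.bound l hl x) (hg.bound l hl x)
  · rw [h n le_rfl, Pi.add_apply, Pi.add_apply, add_sub_add_comm, add_mul]
    exact norm_add_le_of_le (hf.holder x y) (hg.holder x y)
  · rw [h l hl, ← add_zero (0 : E [×l]→L[ℝ] F)]
    exact (hf.vanish l hl).add (hg.vanish l hl)

lemma neg (hf : HolderBounded n γ f A) : HolderBounded n γ (-f) A := by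
  have h : ∀ l x, iteratedFDeriv ℝ l (-f) x = -iteratedFDeriv ℝ l f x :=
    fun l x => iteratedFDeriv_neg_apply
  refine ⟨hf.contDiff.neg, fun l hl x => ?_, fun x y => ?_, fun l hl => ?_⟩
  · rw [h, norm_neg]
    exact hf.bound l hl x
  · rw [h, h, neg_sub_neg, norm_sub_rev]
    exact hf.holder x y
  · rw [← neg_zero]
    exact (hf.vanish l hl).neg.congr fun x => (h l x).symm

lemma sub (hf : HolderBounded n γ f A) (hg : HolderBounded n γ g B) :
    HolderBounded n γ (f - g) (A + B) := by
  rw [sub_eq_add_neg]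
  exact hf.add hg.neg

lemma zero_iff : HolderBounded 0 γ f C ↔ Continuous f ∧ (∀ x, ‖f x‖ ≤ C) ∧
    (∀ x y, ‖f x - f y‖ ≤ C * dist x y ^ (γ : ℝ)) ∧ Tendsto f (Bornology.cobounded E) (𝓝 0) := by
  have hs : ∀ x y, ‖iteratedFDeriv ℝ 0 f x - iteratedFDeriv ℝ 0 f y‖ = ‖f x - f y‖ := fun x y => by
    rw [iteratedFDeriv_zero_eq_comp, Function.comp_apply, Function.comp_apply, ← map_sub,
      LinearIsometryEquiv.norm_map]
  have ht : Tendsto (iteratedFDeriv ℝ 0 f) (Bornology.cobounded E) (𝓝 0) ↔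
      Tendsto f (Bornology.cobounded E) (𝓝 0) := by
    rw [tendsto_zero_iff_norm_tendsto_zero, tendsto_zero_iff_norm_tendsto_zero (f := f)]
    simp only [norm_iteratedFDeriv_zero]
  constructor
  · intro h
    refine ⟨h.contDiff.continuous, h.norm_le, fun x y => ?_, ht.1 (h.vanish 0 le_rfl)⟩
    rw [← hs]
    exact h.holder x y
  · rintro ⟨h1, h2, h3, h4⟩
    refine ⟨contDiff_zero.2 h1, fun l hl x => ?_, fun x y => ?_, fun l hl => ?_⟩
    · obtain rfl := Nat.le_zero.1 hl
      rw [norm_iteratedFDeriv_zero]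
      exact h2 x
    · rw [hs]
      exact h3 x y
    · obtain rfl := Nat.le_zero.1 hl
      exact ht.2 h4

lemma norm_iteratedFDeriv_succ_sub (l : ℕ) (f : E → F) (x y : E) :
    ‖iteratedFDeriv ℝ (l + 1) f x - iteratedFDeriv ℝ (l + 1) f y‖ =
      ‖iteratedFDeriv ℝ l (fderiv ℝ f) x - iteratedFDeriv ℝ l (fderiv ℝ f) y‖ := by
  let e := (continuousMultilinearCurryRightEquiv' ℝ l E F).symm
  rw [iteratedFDeriv_succ_eq_comp_right, iteratedFDeriv_succ_eq_comp_right]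
  exact (congrArg norm (e.map_sub _ _).symm).trans (e.norm_map _)

/-- Together with `zero_iff` this reduces all later estimates to inductions on the order that pass
from `f` to its derivative, so no formula for higher derivatives of products or compositions is
needed. The constant does not change. -/
lemma succ_iff : HolderBounded (n + 1) γ f C ↔ Differentiable ℝ f ∧ (∀ x, ‖f x‖ ≤ C) ∧
    Tendsto f (Bornology.cobounded E) (𝓝 0) ∧ HolderBounded n γ (fderiv ℝ f) C := by
  have ht : ∀ l, Tendsto (iteratedFDeriv ℝ (l + 1) f) (Bornology.cobounded E) (𝓝 0) ↔
      Tendsto (iteratedFDeriv ℝ l (fderiv ℝ f)) (Bornology.cobounded E) (𝓝 0) := by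
    intro l
    rw [tendsto_zero_iff_norm_tendsto_zero,
      tendsto_zero_iff_norm_tendsto_zero (f := iteratedFDeriv ℝ l (fderiv ℝ f))]
    simp only [norm_iteratedFDeriv_fderiv]
  have ht0 : Tendsto (iteratedFDeriv ℝ 0 f) (Bornology.cobounded E) (𝓝 0) ↔
      Tendsto f (Bornology.cobounded E) (𝓝 0) := by
    rw [tendsto_zero_iff_norm_tendsto_zero, tendsto_zero_iff_norm_tendsto_zero (f := f)]
    simp only [norm_iteratedFDeriv_zero]
  have hc : ContDiff ℝ (n + 1 : ℕ) f ↔ Differentiable ℝ f ∧ ContDiff ℝ n (fderiv ℝ f) := by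
    rw [Nat.cast_add, Nat.cast_one, contDiff_succ_iff_fderiv]
    simp
  constructor
  · intro h
    obtain ⟨h1, h2⟩ := hc.1 h.contDiff
    refine ⟨h1, h.norm_le, ht0.1 (h.vanish 0 (Nat.zero_le _)), h2, fun l hl x => ?_,
      fun x y => ?_, fun l hl => ?_⟩
    · rw [norm_iteratedFDeriv_fderiv]
      exact h.bound _ (Nat.succ_le_succ hl) x
    · rw [← norm_iteratedFDeriv_succ_sub]
      exact h.holder x y
    · exact (ht l).1 (h.vanish _ (Nat.succ_le_succ hl))
  · rintro ⟨h1, h2, h3, h4⟩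
    refine ⟨hc.2 ⟨h1, h4.contDiff⟩, fun l hl x => ?_, fun x y => ?_, fun l hl => ?_⟩
    · cases l with
      | zero => rw [norm_iteratedFDeriv_zero]; exact h2 x
      | succ l =>
        rw [← norm_iteratedFDeriv_fderiv]
        exact h4.bound l (Nat.le_of_succ_le_succ hl) x
    · rw [norm_iteratedFDeriv_succ_sub]
      exact h4.holder x y
    · cases l with
      | zero => exact ht0.2 h3
      | succ l => exact (ht l).2 (h4.vanish l (Nat.le_of_succ_le_succ hl))

/-- For `r ≤ 1` lowering the exponent increases the power; for `r ≥ 1` the trivial bound `2 * C` is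
enough. -/
lemma le_two_mul_rpow {a b C r s : ℝ} (ha : 0 ≤ a) (hab : a ≤ b) (hC : 0 ≤ C) (hr : 0 ≤ r)
    (h1 : s ≤ 2 * C) (h2 : s ≤ C * r ^ b) : s ≤ 2 * C * r ^ a := by
  rcases le_total r 1 with h | h
  · have h3 : r ^ b ≤ r ^ a := by
      rcases hr.eq_or_lt with rfl | hr
      · rcases ha.eq_or_lt with rfl | ha
        · simpa using Real.rpow_le_one le_rfl zero_le_one hab
        · rw [Real.zero_rpow ha.ne', Real.zero_rpow (ha.trans_le hab).ne']
      · exact Real.rpow_le_rpow_of_exponent_ge hr h hab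
    have h4 : 0 ≤ r ^ a := by positivity
    nlinarith [mul_le_mul_of_nonneg_left h3 hC]
  · have h3 : 1 ≤ r ^ a := Real.one_le_rpow h ha
    nlinarith

lemma of_exponent_le (h : HolderBounded n β f C) (hαβ : α ≤ β) : HolderBounded n α f (2 * C) where
  contDiff := h.contDiff
  bound l hl x := (h.bound l hl x).trans (by linarith [h.nonneg])
  holder x y := by
    refine le_two_mul_rpow α.2 (NNReal.coe_le_coe.2 hαβ) h.nonneg dist_nonneg ?_ (h.holder x y)
    rw [two_mul]
    exact (norm_sub_le _ _).trans (add_le_add (h.bound n le_rfl x) (h.bound n le_rfl y))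
  vanish := h.vanish

lemma differentiable (h : HolderBounded (n + 1) γ f C) : Differentiable ℝ f := (succ_iff.1 h).1

lemma fderiv (h : HolderBounded (n + 1) γ f C) : HolderBounded n γ (fderiv ℝ f) C :=
  (succ_iff.1 h).2.2.2

lemma norm_sub_le (h : HolderBounded (n + 1) γ f C) (x y : E) : ‖f x - f y‖ ≤ C * ‖x - y‖ :=
  Convex.norm_image_sub_le_of_norm_fderiv_le (𝕜 := ℝ) (fun _ _ => h.differentiable _)
    (fun z _ => h.fderiv.norm_le z) convex_univ (Set.mem_univ y) (Set.mem_univ x)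

lemma norm_iteratedFDeriv_sub_le (h : HolderBounded (n + 1) γ f C) (x y : E) :
    ‖iteratedFDeriv ℝ n f x - iteratedFDeriv ℝ n f y‖ ≤ C * ‖x - y‖ := by
  refine Convex.norm_image_sub_le_of_norm_fderiv_le (𝕜 := ℝ) (fun z _ => ?_)
    (fun z _ => ?_) convex_univ (Set.mem_univ y) (Set.mem_univ x)
  · exact (h.contDiff.differentiable_iteratedFDeriv (by exact_mod_cast n.lt_succ_self)) z
  · rw [norm_fderiv_iteratedFDeriv]
    exact h.bound _ le_rfl z

lemma of_succ (h : HolderBounded (n + 1) γ f C) (hα : α ≤ 1) : HolderBounded n α f (2 * C) where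
  contDiff := h.contDiff.of_le (by exact_mod_cast n.le_succ)
  bound l hl x := (h.bound l (hl.trans n.le_succ) x).trans (by linarith [h.nonneg])
  holder x y := by
    refine le_two_mul_rpow (b := 1) α.2 (by exact_mod_cast hα) h.nonneg dist_nonneg ?_ ?_
    · rw [two_mul]
      exact (_root_.norm_sub_le _ _).trans
        (add_le_add (h.bound n n.le_succ x) (h.bound n n.le_succ y))
    · rw [Real.rpow_one, dist_eq_norm]
      exact h.norm_iteratedFDeriv_sub_le x y
  vanish l hl := h.vanish l (hl.trans n.le_succ)

lemma of_le_succ (hγ : γ ≤ 1) : ∀ {m : ℕ}, HolderBounded (n + m) γ f C →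
    HolderBounded n γ f (2 ^ m * C) := by
  intro m
  induction m generalizing C with
  | zero => intro h; simpa using h
  | succ m ih =>
    intro h
    have := ih (of_succ (n := n + m) h hγ)
    rwa [pow_succ, mul_assoc]

end General

/-! ### Products, and composition with `Id + φ` -/

section Composition

variable {E : Type w} [NormedAddCommGroup E] [NormedSpace ℝ E] {α β γ : ℝ≥0}

/-- Leibniz rule and induction on the order. The target spaces are quantified after `c` because the
induction replaces `F` by `E →L[ℝ] F`; this is also why all spaces share one universe. -/
lemma bilinear (hγ : γ ≤ 1) (n : ℕ) : ∃ c : ℝ, 0 ≤ c ∧ ∀ (F G H : Type w)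
    [NormedAddCommGroup F] [NormedSpace ℝ F] [NormedAddCommGroup G] [NormedSpace ℝ G]
    [NormedAddCommGroup H] [NormedSpace ℝ H] (L : F →L[ℝ] G →L[ℝ] H) (f : E → F) (g : E → G)
    (A B : ℝ), ‖L‖ ≤ 1 → HolderBounded n γ f A → HolderBounded n γ g B →
    HolderBounded n γ (fun x => L (f x) (g x)) (c * (A * B)) := by
  have hL : ∀ {F G H : Type w} [NormedAddCommGroup F] [NormedSpace ℝ F] [NormedAddCommGroup G]
      [NormedSpace ℝ G] [NormedAddCommGroup H] [NormedSpace ℝ H] (L : F →L[ℝ] G →L[ℝ] H),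
      ‖L‖ ≤ 1 → ∀ x y {A B : ℝ}, ‖x‖ ≤ A → ‖y‖ ≤ B → ‖L x y‖ ≤ A * B := by
    intro F G H _ _ _ _ _ _ L hL x y A B hx hy
    have hA := (norm_nonneg x).trans hx
    calc ‖L x y‖ ≤ ‖L‖ * ‖x‖ * ‖y‖ := L.le_opNorm₂ x y
      _ ≤ 1 * A * B := by gcongr
      _ = A * B := by ring
  have hv : ∀ {F G H : Type w} [NormedAddCommGroup F] [NormedSpace ℝ F] [NormedAddCommGroup G]
      [NormedSpace ℝ G] [NormedAddCommGroup H] [NormedSpace ℝ H] (L : F →L[ℝ] G →L[ℝ] H)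
      {f : E → F} {g : E → G}, Tendsto f (Bornology.cobounded E) (𝓝 0) →
      Tendsto g (Bornology.cobounded E) (𝓝 0) →
      Tendsto (fun x => L (f x) (g x)) (Bornology.cobounded E) (𝓝 0) := by
    intro F G H _ _ _ _ _ _ L f g hf hg
    have h := (L.continuous₂.tendsto (0, 0)).comp (hf.prodMk_nhds hg)
    rwa [Function.uncurry_apply_pair, map_zero] at h
  induction n with
  | zero =>
    refine ⟨2, zero_le_two, fun F G H _ _ _ _ _ _ L f g A B hL1 hf hg => ?_⟩
    have hA := hf.nonneg
    have hB := hg.nonneg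
    obtain ⟨f1, f2, f3, f4⟩ := zero_iff.1 hf
    obtain ⟨g1, g2, g3, g4⟩ := zero_iff.1 hg
    refine zero_iff.2 ⟨L.continuous₂.comp (f1.prodMk g1), fun x => ?_, fun x y => ?_, hv L f4 g4⟩
    · exact (hL L hL1 _ _ (f2 x) (g2 x)).trans (by nlinarith [mul_nonneg hA hB])
    · have : L (f x) (g x) - L (f y) (g y) = L (f x - f y) (g x) + L (f y) (g x - g y) := by
        simp
      rw [this]
      have h1 := hL L hL1 _ _ (f3 x y) (g2 x)
      have h2 := hL L hL1 _ _ (f2 y) (g3 x y)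
      exact (norm_add_le_of_le h1 h2).trans_eq (by ring)
  | succ n ih =>
    obtain ⟨c, hc, ih⟩ := ih
    -- The `1` covers the sup norm. The Leibniz rule has two terms, and in each the undifferentiated
    -- factor is lowered by one order, which doubles its constant.
    refine ⟨1 + 4 * c, by positivity, fun F G H _ _ _ _ _ _ L f g A B hL1 hf hg => ?_⟩
    have hA := hf.nonneg
    have hB := hg.nonneg
    have hAB := mul_nonneg hA hB
    obtain ⟨f1, f2, f3, f4⟩ := succ_iff.1 hf
    obtain ⟨g1, g2, g3, g4⟩ := succ_iff.1 hg
    refine succ_iff.2 ⟨?_, fun x => ?_, hv L f3 g3, ?_⟩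
    · exact fun x => (L.hasFDerivAt_of_bilinear (f1 x).hasFDerivAt (g1 x).hasFDerivAt).differentiableAt
    · exact (hL L hL1 _ _ (f2 x) (g2 x)).trans (by nlinarith [mul_nonneg hc hAB])
    · have h1 := ih _ _ _ (L.precompR E) f (_root_.fderiv ℝ g) _ _
        ((ContinuousLinearMap.norm_precompR_le E L).trans hL1) (hf.of_succ hγ) g4
      have h2 := ih _ _ _ (L.precompL E) (_root_.fderiv ℝ f) g _ _
        ((ContinuousLinearMap.norm_precompL_le E L).trans hL1) f4 (hg.of_succ hγ)
      have h3 := (h1.add h2).mono (B := (1 + 4 * c) * (A * B)) (by nlinarith)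
      convert h3 using 1
      ext1 x
      exact L.fderiv_of_bilinear (f1 x) (g1 x)

omit [NormedSpace ℝ E] in
lemma tendsto_id_add_cobounded {φ : E → E} {R : ℝ} (hφ : ∀ x, ‖φ x‖ ≤ R) :
    Tendsto (fun x => x + φ x) (Bornology.cobounded E) (Bornology.cobounded E) := by
  rw [← comap_norm_atTop, tendsto_comap_iff]
  refine tendsto_atTop_mono (f := fun x => ‖x‖ - R) (fun x => ?_) ?_
  · have := norm_sub_le_norm_add x (φ x)
    simp only [Function.comp_apply]
    linarith [hφ x]
  · exact tendsto_atTop_add_const_right _ _ tendsto_comap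

/-- Induction through `D(f ∘ (Id + φ)) = Df ∘ (Id + φ) + (Df ∘ (Id + φ)) · Dφ`. The first derivative
of `φ` is bounded by a separate hypothesis, so that at order `0` the map `Id + φ` is still
Lipschitz. -/
lemma comp_id_add (hγ : γ ≤ 1) (n : ℕ) (R : ℝ) : ∃ c : ℝ, 0 ≤ c ∧ ∀ (F : Type w)
    [NormedAddCommGroup F] [NormedSpace ℝ F] (f : E → F) (φ : E → E) (A : ℝ),
    HolderBounded n γ φ R → Differentiable ℝ φ → (∀ x, ‖_root_.fderiv ℝ φ x‖ ≤ R) →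
    HolderBounded n γ f A → HolderBounded n γ (fun x => f (x + φ x)) (c * A) := by
  induction n generalizing R with
  | zero =>
    refine ⟨1 + |R|, by positivity, fun F _ _ f φ A hφ hd hb hf => ?_⟩
    have hR := hφ.nonneg
    rw [abs_of_nonneg hR]
    have hA := hf.nonneg
    obtain ⟨f1, f2, f3, f4⟩ := zero_iff.1 hf
    refine zero_iff.2 ⟨f1.comp (continuous_id.add hd.continuous), fun x => ?_, fun x y => ?_,
      f4.comp (tendsto_id_add_cobounded hφ.norm_le)⟩
    · exact (f2 _).trans (by nlinarith)
    · have h1 : dist (x + φ x) (y + φ y) ≤ (1 + R) * dist x y := by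
        have h2 : ‖φ x - φ y‖ ≤ R * ‖x - y‖ :=
          Convex.norm_image_sub_le_of_norm_fderiv_le (𝕜 := ℝ) (fun _ _ => hd _)
            (fun z _ => hb z) convex_univ (Set.mem_univ y) (Set.mem_univ x)
        rw [dist_eq_norm, dist_eq_norm, add_sub_add_comm]
        exact (norm_add_le_of_le le_rfl h2).trans_eq (by ring)
      calc ‖f (x + φ x) - f (y + φ y)‖ ≤ A * dist (x + φ x) (y + φ y) ^ (γ : ℝ) := f3 _ _
        _ ≤ A * ((1 + R) * dist x y) ^ (γ : ℝ) := by gcongr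
        _ = A * ((1 + R) ^ (γ : ℝ) * dist x y ^ (γ : ℝ)) := by
          rw [Real.mul_rpow (by positivity) dist_nonneg]
        _ ≤ A * ((1 + R) ^ (1 : ℝ) * dist x y ^ (γ : ℝ)) := by
          gcongr
          · linarith
          · exact_mod_cast hγ
        _ = (1 + R) * A * dist x y ^ (γ : ℝ) := by rw [Real.rpow_one]; ring
  | succ n ih =>
    -- Regarding `φ` as a function of one order less doubles its constant.
    obtain ⟨c, hc, ih⟩ := ih (2 * R)
    obtain ⟨b, hb0, hbil⟩ := bilinear (E := E) hγ n
    refine ⟨1 + c + b * c * |R|, by positivity, fun F _ _ f φ A hφ hd hb hf => ?_⟩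
    have hR := hφ.nonneg
    rw [abs_of_nonneg hR]
    have hA := hf.nonneg
    obtain ⟨f1, f2, f3, f4⟩ := succ_iff.1 hf
    have hd' : Differentiable ℝ fun x => x + φ x := differentiable_id.add hd
    refine succ_iff.2 ⟨f1.comp hd', fun x => ?_, f3.comp (tendsto_id_add_cobounded hφ.norm_le), ?_⟩
    · refine (f2 _).trans ?_
      have := mul_nonneg (mul_nonneg (mul_nonneg hb0 hc) hR) hA
      nlinarith [mul_nonneg hc hA]
    · have h1 := ih _ (_root_.fderiv ℝ f) φ A (hφ.of_succ hγ) hd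
        (fun x => (hb x).trans (by linarith)) f4
      have h2 := hbil _ _ _ (ContinuousLinearMap.compL ℝ E E F) _ _ _ _
        (ContinuousLinearMap.norm_compL_le ℝ E E F) h1 hφ.fderiv
      have h3 := (h1.add h2).mono (B := (1 + c + b * c * R) * A) (by nlinarith)
      convert h3 using 1
      ext1 x
      have h4 := (f1 (x + φ x)).hasFDerivAt.comp x ((hasFDerivAt_id x).add (hd x).hasFDerivAt)
      refine h4.fderiv.trans ?_
      rw [ContinuousLinearMap.comp_add]
      rfl

end Composition

/-! ### Interpolation between the sup norm and `C^{n,β}` -/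

section Interpolation

/-- Landau-type inequality: the derivative in a unit direction is compared with the difference
quotient of step `h`, which is at most `2 * δ / h`; the error is the oscillation of the derivative
over distance `h`. -/
lemma norm_fderiv_le {E F : Type*} [NormedAddCommGroup E] [NormedSpace ℝ E]
    [NormedAddCommGroup F] [NormedSpace ℝ F] {f : E → F} {R δ h b : ℝ} (hb : 0 ≤ b) (hh : 0 < h)
    (hR : 0 ≤ R) (hf : Differentiable ℝ f) (hδ : ∀ x, ‖f x‖ ≤ δ)
    (hd : ∀ x y, ‖_root_.fderiv ℝ f x - _root_.fderiv ℝ f y‖ ≤ R * dist x y ^ b) (x : E) :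
    ‖_root_.fderiv ℝ f x‖ ≤ 2 * δ / h + R * h ^ b := by
  have hδ0 : 0 ≤ δ := (norm_nonneg _).trans (hδ x)
  refine ContinuousLinearMap.opNorm_le_of_unit_norm (by positivity) fun v hv => ?_
  have hn : ‖x + h • v - x‖ = h := by
    rw [add_sub_cancel_left, norm_smul, hv, mul_one, Real.norm_of_nonneg hh.le]
  have h1 : ‖f (x + h • v) - f x - _root_.fderiv ℝ f x (x + h • v - x)‖ ≤
      R * h ^ b * ‖x + h • v - x‖ := by
    refine Convex.norm_image_sub_le_of_norm_fderiv_le' (𝕜 := ℝ) (s := Metric.closedBall x h)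
      (fun z _ => hf z) (fun z hz => ?_) (convex_closedBall x h)
      (Metric.mem_closedBall_self hh.le) ?_
    · refine (hd z x).trans ?_
      have : dist z x ≤ h := hz
      gcongr
    · rw [mem_closedBall_iff_norm, hn]
  have h2 : _root_.fderiv ℝ f x (x + h • v - x) = h • _root_.fderiv ℝ f x v := by
    rw [add_sub_cancel_left, map_smul]
  have h3 : h * ‖_root_.fderiv ℝ f x v‖ ≤ 2 * δ + R * h ^ b * h := by
    rw [hn] at h1
    calc h * ‖_root_.fderiv ℝ f x v‖ = ‖h • _root_.fderiv ℝ f x v‖ := by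
          rw [norm_smul, Real.norm_of_nonneg hh.le]
      _ = ‖f (x + h • v) - f x - (f (x + h • v) - f x - _root_.fderiv ℝ f x (x + h • v - x))‖ := by
          rw [sub_sub_cancel, h2]
      _ ≤ δ + δ + R * h ^ b * h :=
          norm_sub_le_of_le (norm_sub_le_of_le (hδ _) (hδ _)) h1
      _ = 2 * δ + R * h ^ b * h := by ring
  rw [← mul_le_mul_iff_right₀ hh]
  refine h3.trans_eq ?_
  field_simp

lemma exists_pos_mul_rpow_le {R ε b : ℝ} (hR : 0 ≤ R) (hε : 0 < ε) (hb : 0 < b) :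
    ∃ h : ℝ, 0 < h ∧ R * h ^ b ≤ ε := by
  refine ⟨(ε / (R + 1)) ^ (1 / b), by positivity, ?_⟩
  rw [← Real.rpow_mul (by positivity), one_div_mul_cancel hb.ne', Real.rpow_one, mul_div_assoc',
    div_le_iff₀ (by positivity)]
  nlinarith

lemma interpolation {E : Type w} [NormedAddCommGroup E] [NormedSpace ℝ E] {α β : ℝ≥0}
    (hαβ : α < β) (hβ : β ≤ 1) (n : ℕ) {R ε : ℝ} (hR : 0 ≤ R) (hε : 0 < ε) :
    ∃ δ : ℝ, 0 < δ ∧ ∀ (F : Type w) [NormedAddCommGroup F] [NormedSpace ℝ F] (f : E → F),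
      HolderBounded n β f R → (∀ x, ‖f x‖ ≤ δ) → HolderBounded n α f ε := by
  have hαβ' : (0 : ℝ) < β - α := sub_pos.2 (NNReal.coe_lt_coe.2 hαβ)
  induction n with
  | zero =>
    obtain ⟨ρ, hρ, hρR⟩ := exists_pos_mul_rpow_le hR hε hαβ'
    -- At distances below `ρ` the `β`-Hölder bound gains the factor `ρ ^ (β - α)`; above `ρ` twice
    -- the sup bound is at most `ε * ρ ^ α`.
    refine ⟨min ε (ε * ρ ^ (α : ℝ) / 2), by positivity, fun F _ _ f hf hδ => ?_⟩
    obtain ⟨f1, f2, f3, f4⟩ := zero_iff.1 hf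
    refine zero_iff.2 ⟨f1, fun x => (hδ x).trans (min_le_left _ _), fun x y => ?_, f4⟩
    rcases le_total (dist x y) ρ with h | h
    · refine (f3 x y).trans ?_
      have h1 : dist x y ^ (β : ℝ) = dist x y ^ (β - α : ℝ) * dist x y ^ (α : ℝ) := by
        rw [← Real.rpow_add_of_nonneg dist_nonneg hαβ'.le α.coe_nonneg, sub_add_cancel]
      rw [h1, ← mul_assoc]
      gcongr
      refine le_trans ?_ hρR
      gcongr
    · calc ‖f x - f y‖ ≤ ε * ρ ^ (α : ℝ) / 2 + ε * ρ ^ (α : ℝ) / 2 :=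
          norm_sub_le_of_le ((hδ x).trans (min_le_right _ _)) ((hδ y).trans (min_le_right _ _))
        _ = ε * ρ ^ (α : ℝ) := by ring
        _ ≤ ε * dist x y ^ (α : ℝ) := by gcongr
  | succ n ih =>
    obtain ⟨δ, hδ, ih⟩ := ih
    have hβ0 : (0 : ℝ) < β := hαβ'.trans_le (sub_le_self _ α.2)
    obtain ⟨h, hh, hhR⟩ := exists_pos_mul_rpow_le (mul_nonneg (pow_nonneg zero_le_two n) hR)
      (half_pos hδ) hβ0
    -- In `norm_fderiv_le` this makes the difference quotient term `δ / 2`, and `h` was chosen to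
    -- make the Hölder term at most `δ / 2`; the induction hypothesis then applies to the
    -- derivative.
    refine ⟨min ε (δ * h / 4), by positivity, fun F _ _ f hf hb => ?_⟩
    obtain ⟨f1, f2, f3, f4⟩ := succ_iff.1 hf
    refine succ_iff.2 ⟨f1, fun x => (hb x).trans (min_le_left _ _), f3, ih _ _ f4 fun x => ?_⟩
    have h0 : HolderBounded 0 β (_root_.fderiv ℝ f) (2 ^ n * R) :=
      of_le_succ hβ (by rwa [zero_add])
    refine (norm_fderiv_le hβ0.le hh h0.nonneg f1 (fun x => (hb x).trans (min_le_right _ _))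
      (zero_iff.1 h0).2.2.1 x).trans ?_
    have : 2 * (δ * h / 4) / h = δ / 2 := by field_simp; norm_num
    rw [this]
    linarith

end Interpolation

end HolderBounded

namespace HolderBounded

lemma comp_id_add_succ {E : Type w} [NormedAddCommGroup E] [NormedSpace ℝ E] {γ : ℝ≥0} (hγ : γ ≤ 1)
    (n : ℕ) (R : ℝ) : ∃ c : ℝ, 0 ≤ c ∧ ∀ (F : Type w) [NormedAddCommGroup F] [NormedSpace ℝ F]
    (f : E → F) (φ : E → E) (A : ℝ), HolderBounded (n + 1) γ φ R → HolderBounded (n + 1) γ f A →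
    HolderBounded (n + 1) γ (fun x => f (x + φ x)) (c * A) := by
  obtain ⟨c, hc, h⟩ := comp_id_add (E := E) hγ (n + 1) R
  exact ⟨c, hc, fun F _ _ f φ A hφ hf => h F f φ A hφ hφ.differentiable hφ.fderiv.norm_le hf⟩

variable {E F : Type*} [NormedAddCommGroup E] [NormedSpace ℝ E]
  [NormedAddCommGroup F] [NormedSpace ℝ F] {n : ℕ} {γ : ℝ≥0} {f : E → F} {C : ℝ}

lemma holderENorm_le (h : HolderBounded n γ f C) : holderENorm n γ f ≤ ENNReal.ofReal C := by
  refine max_le (iSup_le fun l => iSup_le fun hl => iSup_le fun x => ?_) ?_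
  · rw [← ofReal_norm]
    exact ENNReal.ofReal_le_ofReal (h.bound l hl x)
  · refine HolderWith.eHolderNorm_le (C := C.toNNReal) fun x y => ?_
    rw [edist_dist, edist_dist, ENNReal.ofReal_rpow_of_nonneg dist_nonneg γ.coe_nonneg]
    change _ ≤ ENNReal.ofReal _ * _
    rw [← ENNReal.ofReal_mul h.nonneg, dist_eq_norm]
    exact ENNReal.ofReal_le_ofReal (h.holder x y)

lemma isC0Holder (h : HolderBounded n γ f C) : IsC0Holder n γ f where
  contDiff := h.contDiff
  norm_lt_top := h.holderENorm_le.trans_lt ENNReal.ofReal_lt_top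
  tendsto_zero l hl ε hε := by
    have h1 := (h.vanish l hl).norm
    rw [norm_zero, ← comap_norm_atTop] at h1
    obtain ⟨s, hs, hsub⟩ := mem_comap.1 (h1 (Iic_mem_nhds hε))
    obtain ⟨r, hr⟩ := mem_atTop_sets.1 hs
    exact ⟨max r 1, by positivity, fun x hx => hsub (hr _ ((le_max_left _ _).trans hx.le))⟩

end HolderBounded

/-! ### Evaluations, limits and integrals in the Hölder spaces -/

namespace C0Holder

section General

variable {E F : Type*} [NormedAddCommGroup E] [NormedSpace ℝ E]
  [NormedAddCommGroup F] [NormedSpace ℝ F] {n : ℕ} {α β γ : ℝ≥0}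

lemma norm_le_of_holderBounded {f : C0Holder n γ E F} {C : ℝ} (h : HolderBounded n γ f C) :
    ‖f‖ ≤ C :=
  ENNReal.toReal_le_of_le_ofReal h.nonneg h.holderENorm_le

lemma holderBounded (f : C0Holder n γ E F) : HolderBounded n γ f ‖f‖ where
  contDiff := f.isC0Holder.contDiff
  bound _ hl x := f.norm_iteratedFDeriv_le hl x
  holder := f.norm_iteratedFDeriv_sub_le
  vanish l hl := by
    rw [Metric.tendsto_nhds, ← comap_norm_atTop]
    intro ε hε
    obtain ⟨r, _, hr⟩ := f.isC0Holder.tendsto_zero l hl (ε / 2) (half_pos hε)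
    filter_upwards [(eventually_gt_atTop r).comap norm] with x hx
    rw [dist_zero_right]
    exact (hr x hx).trans_lt (half_lt_self hε)

/-- The `l`-th derivative at a point, as a continuous linear map on `C^{n,γ}_0`. -/
noncomputable def iteratedFDerivCLM (n : ℕ) (γ : ℝ≥0) (F : Type*) [NormedAddCommGroup F]
    [NormedSpace ℝ F] {l : ℕ} (hl : l ≤ n) (x : E) : C0Holder n γ E F →L[ℝ] E [×l]→L[ℝ] F :=
  LinearMap.mkContinuous
    { toFun := fun f => iteratedFDeriv ℝ l f x
      map_add' := fun f g => iteratedFDeriv_add_apply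
        (f.isC0Holder.contDiff.of_le (by exact_mod_cast hl)).contDiffAt
        (g.isC0Holder.contDiff.of_le (by exact_mod_cast hl)).contDiffAt
      map_smul' := fun c f => iteratedFDeriv_const_smul_apply
        (f.isC0Holder.contDiff.of_le (by exact_mod_cast hl)).contDiffAt } 1
    fun f => by rw [one_mul]; exact f.norm_iteratedFDeriv_le hl x

/-- Evaluation at a point, as a continuous linear map on `C^{n,γ}_0`. -/
noncomputable def evalCLM (n : ℕ) (γ : ℝ≥0) (F : Type*) [NormedAddCommGroup F]
    [NormedSpace ℝ F] (x : E) : C0Holder n γ E F →L[ℝ] F :=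
  LinearMap.mkContinuous
    { toFun := fun f => f x
      map_add' := fun _ _ => rfl
      map_smul' := fun _ _ => rfl } 1
    fun f => by rw [one_mul]; exact f.norm_apply_le x

@[simp] lemma evalCLM_apply (x : E) (f : C0Holder n γ E F) : evalCLM n γ F x f = f x := rfl

/-- Derivatives at a point are continuous on `C^{n,α}_0`, so a `β`-ball is closed under `α`-limits.
-/
lemma holderBounded_of_tendsto {ι : Type*} {l : Filter ι} [l.NeBot] {f : ι → C0Holder n α E F}
    {g : C0Holder n α E F} {R : ℝ} (hf : Tendsto f l (𝓝 g))
    (h : ∀ i, HolderBounded n β (f i) R) : HolderBounded n β g R where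
  contDiff := g.isC0Holder.contDiff
  bound k hk x := le_of_tendsto
    (((iteratedFDerivCLM n α F hk x).continuous.tendsto g).comp hf).norm
    (Eventually.of_forall fun i => (h i).bound k hk x)
  holder x y := le_of_tendsto
    ((((iteratedFDerivCLM n α F le_rfl x).continuous.tendsto g).comp hf).sub
      (((iteratedFDerivCLM n α F le_rfl y).continuous.tendsto g).comp hf)).norm
    (Eventually.of_forall fun i => (h i).holder x y)
  vanish := g.holderBounded.vanish

/-- Derivatives at a point commute with the integral. Thus an integral taken in `C^{n,α}_0` inherits
`β`-bounds although the integrand need not be measurable into `C^{n,β}_0`. -/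
lemma holderBounded_integral [CompleteSpace F] {X : Type*} [MeasurableSpace X] {μ : Measure X}
    {f : X → C0Holder n α E F} {g : X → ℝ} (hf : Integrable f μ) (hg : Integrable g μ)
    (h : ∀ s, HolderBounded n β (f s) (g s)) :
    HolderBounded n β (∫ s, f s ∂μ : C0Holder n α E F) (∫ s, g s ∂μ) := by
  have key : ∀ {k : ℕ} (hk : k ≤ n) (x : E), iteratedFDeriv ℝ k (∫ s, f s ∂μ : C0Holder n α E F) x =
      ∫ s, iteratedFDeriv ℝ k (f s) x ∂μ := fun hk x =>
    ((iteratedFDerivCLM n α F hk x).integral_comp_comm hf).symm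
  refine ⟨(C0Holder.isC0Holder _).contDiff, fun k hk x => ?_, fun x y => ?_,
    (C0Holder.holderBounded _).vanish⟩
  · rw [key hk]
    exact norm_integral_le_of_norm_le hg (Eventually.of_forall fun s => (h s).bound k hk x)
  · have hi : ∀ z, Integrable (fun s => iteratedFDeriv ℝ n (f s) z) μ := fun z =>
      (iteratedFDerivCLM n α F le_rfl z).integrable_comp hf
    rw [key le_rfl, key le_rfl, ← integral_sub (hi x) (hi y), ← integral_mul_const]
    exact norm_integral_le_of_norm_le (hg.mul_const _)
      (Eventually.of_forall fun s => (h s).holder x y)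

/-- The inclusion `C^{n,β}_0 → C^{n,α}_0` for `α ≤ β`. -/
noncomputable def inclusion (hαβ : α ≤ β) : C0Holder n β E F →L[ℝ] C0Holder n α E F :=
  LinearMap.mkContinuous
    { toFun := fun f => mk f (f.holderBounded.of_exponent_le hαβ).isC0Holder
      map_add' := fun _ _ => rfl
      map_smul' := fun _ _ => rfl } 2
    fun f => norm_le_of_holderBounded (f.holderBounded.of_exponent_le hαβ)

@[simp] lemma inclusion_apply (hαβ : α ≤ β) (f : C0Holder n β E F) (x : E) :
    inclusion hαβ f x = f x := rfl

end General

/-! ### The composition operator and its continuity -/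

section Composition

variable {E F : Type w} [NormedAddCommGroup E] [NormedSpace ℝ E]
  [NormedAddCommGroup F] [NormedSpace ℝ F] {n : ℕ} {α β γ : ℝ≥0}

/-- Composition `f ↦ f ∘ (Id + φ)`, as a continuous linear map. -/
noncomputable def compRight (hγ : γ ≤ 1) (φ : C0Holder (n + 1) γ E E) :
    C0Holder (n + 1) γ E F →L[ℝ] C0Holder (n + 1) γ E F :=
  LinearMap.mkContinuousOfExistsBound
    { toFun := fun f => mk (fun x => f (x + φ x)) <| by
        obtain ⟨c, _, hc⟩ := HolderBounded.comp_id_add_succ (E := E) hγ n ‖φ‖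
        exact (hc F f φ _ φ.holderBounded f.holderBounded).isC0Holder
      map_add' := fun _ _ => rfl
      map_smul' := fun _ _ => rfl } <| by
    obtain ⟨c, _, hc⟩ := HolderBounded.comp_id_add_succ (E := E) hγ n ‖φ‖
    exact ⟨c, fun f => norm_le_of_holderBounded (hc F f φ _ φ.holderBounded f.holderBounded)⟩

@[simp] lemma compRight_apply (hγ : γ ≤ 1) (φ : C0Holder (n + 1) γ E E) (f : C0Holder (n + 1) γ E F)
    (x : E) : compRight hγ φ f x = f (x + φ x) := rfl

/-- The difference splits as `(f i - g) ∘ (Id + φ i)`, small by linearity and the uniform operator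
bound, plus `g ∘ (Id + φ i) - g ∘ (Id + ψ)`, which is bounded in `C^{n+1,β}` and uniformly small
because `g` is Lipschitz, hence small in `C^{n+1,α}` by interpolation. -/
lemma tendsto_compRight_inclusion (hαβ : α < β) (hβ : β ≤ 1) {R : ℝ} {ι : Type*} {l : Filter ι}
    {f : ι → C0Holder (n + 1) β E F} {g : C0Holder (n + 1) β E F} (hf : Tendsto f l (𝓝 g))
    {φ : ι → C0Holder (n + 1) α E E} {ψ : C0Holder (n + 1) α E E} (hφ : Tendsto φ l (𝓝 ψ))
    (hφR : ∀ i, HolderBounded (n + 1) β (φ i) R) (hψR : HolderBounded (n + 1) β ψ R) :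
    Tendsto (fun i => compRight (hαβ.le.trans hβ) (φ i) (inclusion hαβ.le (f i))) l
      (𝓝 (compRight (hαβ.le.trans hβ) ψ (inclusion hαβ.le g))) := by
  have hα := hαβ.le.trans hβ
  obtain ⟨c, hc, hcomp⟩ := HolderBounded.comp_id_add_succ (E := E) hβ n R
  rw [Metric.tendsto_nhds]
  intro ε hε
  obtain ⟨δ, hδ, hint⟩ := HolderBounded.interpolation (E := E) (n := n + 1) hαβ hβ
    (R := c * ‖g‖ + c * ‖g‖) (by positivity) (show 0 < ε / 3 by positivity)
  have h1 : ∀ᶠ i in l, 2 * (c * ‖f i - g‖) < ε / 3 := by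
    have := ((tendsto_iff_norm_sub_tendsto_zero.1 hf).const_mul c).const_mul 2
    rw [mul_zero, mul_zero] at this
    exact this.eventually_lt_const (by positivity)
  have h2 : ∀ᶠ i in l, ‖g‖ * ‖φ i - ψ‖ < δ := by
    have := (tendsto_iff_norm_sub_tendsto_zero.1 hφ).const_mul ‖g‖
    rw [mul_zero] at this
    exact this.eventually_lt_const hδ
  filter_upwards [h1, h2] with i hi1 hi2
  have h3 : ‖compRight hα (φ i) (inclusion hαβ.le (f i - g))‖ ≤ 2 * (c * ‖f i - g‖) :=
    norm_le_of_holderBounded ((hcomp F _ _ _ (hφR i) (f i - g).holderBounded).of_exponent_le hαβ.le)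
  have h4 : ‖compRight hα (φ i) (inclusion hαβ.le g) - compRight hα ψ (inclusion hαβ.le g)‖ ≤
      ε / 3 := by
    refine norm_le_of_holderBounded (hint F _ ?_ fun x => ?_)
    · exact (hcomp F _ _ _ (hφR i) g.holderBounded).sub (hcomp F _ _ _ hψR g.holderBounded)
    · refine le_trans ?_ hi2.le
      rw [sub_apply]
      refine (g.holderBounded.norm_sub_le _ _).trans ?_
      gcongr
      rw [add_sub_add_left_eq_sub, ← sub_apply]
      exact norm_apply_le _ _
  have h5 : compRight hα (φ i) (inclusion hαβ.le (f i)) - compRight hα ψ (inclusion hαβ.le g) =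
      compRight hα (φ i) (inclusion hαβ.le (f i - g)) +
      (compRight hα (φ i) (inclusion hαβ.le g) - compRight hα ψ (inclusion hαβ.le g)) := by
    rw [map_sub, map_sub]; abel
  rw [dist_eq_norm, h5]
  exact (norm_add_le_of_le h3 h4).trans_lt (by linarith)

lemma continuous_compRight_inclusion (hαβ : α < β) (hβ : β ≤ 1) {R : ℝ} :
    Continuous fun p : C0Holder (n + 1) β E F ×
      {φ : C0Holder (n + 1) α E E // HolderBounded (n + 1) β φ R} =>
      compRight (hαβ.le.trans hβ) p.2.1 (inclusion hαβ.le p.1) :=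
  continuous_iff_continuousAt.2 fun p => tendsto_compRight_inclusion hαβ hβ
    (continuous_fst.tendsto p) ((continuous_subtype_val.comp continuous_snd).tendsto p)
    (fun q => q.2.2) p.2.2

lemma integrable_compRight_inclusion {X : Type*} [TopologicalSpace X] [MeasurableSpace X]
    [OpensMeasurableSpace X] [SecondCountableTopology X] {μ : Measure X}
    (hαβ : α < β) (hβ : β ≤ 1) {R : ℝ} {u : X → C0Holder (n + 1) β E F} (hu : Integrable u μ)
    {φ : X → C0Holder (n + 1) α E E} (hφ : Continuous φ)
    (hR : ∀ s, HolderBounded (n + 1) β (φ s) R) :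
    Integrable (fun s => compRight (hαβ.le.trans hβ) (φ s) (inclusion hαβ.le (u s))) μ := by
  obtain ⟨c, hc, hcomp⟩ := HolderBounded.comp_id_add_succ (E := E) hβ n R
  refine Integrable.mono' (g := fun s => 2 * (c * ‖u s‖)) ((hu.norm.const_mul c).const_mul 2) ?_
    (Eventually.of_forall fun s => ?_)
  · have h1 : Continuous fun s => (⟨φ s, hR s⟩ : {φ : C0Holder (n + 1) α E E //
        HolderBounded (n + 1) β φ R}) := hφ.subtype_mk _
    exact (continuous_compRight_inclusion (R := R) hαβ hβ).comp_aestronglyMeasurable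
      (hu.aestronglyMeasurable.prodMk h1.aestronglyMeasurable)
  · exact norm_le_of_holderBounded
      ((hcomp F _ _ _ (hR s) (u s).holderBounded).of_exponent_le hαβ.le)

end Composition

end C0Holder

lemma continuous_setIntegral_Iic {G : Type*} [NormedAddCommGroup G] [NormedSpace ℝ G] {f : I → G}
    (hf : Integrable f) : Continuous fun t : I => ∫ s in Set.Iic t, f s := by
  simp only [← integral_indicator measurableSet_Iic]
  rw [continuous_iff_continuousAt]
  intro t₀
  refine continuousAt_of_dominated (bound := fun s => ‖f s‖)
    (Eventually.of_forall fun t => (hf.indicator measurableSet_Iic).aestronglyMeasurable)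
    (Eventually.of_forall fun t => Eventually.of_forall fun s => norm_indicator_le_norm_self _ _)
    hf.norm ?_
  -- As a function of `t`, the indicator at `s` can jump only at `t = s`, so the exceptional `s`
  -- form the null set `{t₀}`.
  have h : ∀ᵐ s : I, s ≠ t₀ := by simp [ae_iff]
  filter_upwards [h] with s hs
  refine continuousAt_const (y := Set.indicator (Set.Iic t₀) f s) |>.congr ?_
  rcases hs.lt_or_gt with hs | hs
  · filter_upwards [lt_mem_nhds hs] with t ht
    rw [Set.indicator_of_mem (show s ∈ Set.Iic t₀ from hs.le),
      Set.indicator_of_mem (show s ∈ Set.Iic t from le_of_lt ht)]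
  · filter_upwards [gt_mem_nhds hs] with t ht
    rw [Set.indicator_of_notMem (show s ∉ Set.Iic t₀ from not_le.2 hs),
      Set.indicator_of_notMem (show s ∉ Set.Iic t from not_le.2 ht)]

/-! ### Picard iteration for small `u` -/

namespace C0Holder

variable {E : Type w} [NormedAddCommGroup E] [NormedSpace ℝ E] {n : ℕ} {α β : ℝ≥0}

/-- `Id + φ` is a flow of `u` in `C^{n+1,α}_0`. -/
structure IsFlow (hαβ : α < β) (hβ : β ≤ 1) (u : I → C0Holder (n + 1) β E E)
    (φ : I → C0Holder (n + 1) α E E) : Prop where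
  continuous : Continuous φ
  integrable : Integrable fun s => compRight (hαβ.le.trans hβ) (φ s) (inclusion hαβ.le (u s))
  eq_integral : ∀ t, φ t =
    ∫ s in Set.Iic t, compRight (hαβ.le.trans hβ) (φ s) (inclusion hαβ.le (u s))

variable [CompleteSpace E]

/-- Each `u s` is `‖u s‖`-Lipschitz. The set `J` is the whole interval in the contraction estimate,
and a short interval after the time of agreement in the uniqueness proof. -/
lemma norm_integral_compRight_sub_le (hαβ : α < β) (hβ : β ≤ 1) {u : I → C0Holder (n + 1) β E E}
    (hu : Integrable u) {φ ψ : I → C0Holder (n + 1) α E E} {δ : ℝ}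
    (hφ : Integrable fun s => compRight (hαβ.le.trans hβ) (φ s) (inclusion hαβ.le (u s)))
    (hψ : Integrable fun s => compRight (hαβ.le.trans hβ) (ψ s) (inclusion hαβ.le (u s)))
    {t : I} {x : E} {J : Set I} (hJ : MeasurableSet J) (h : ∀ s ∈ J, ‖φ s x - ψ s x‖ ≤ δ)
    (h' : ∀ s ≤ t, s ∉ J → φ s x = ψ s x) (hδ : 0 ≤ δ) :
    ‖(∫ s in Set.Iic t, compRight (hαβ.le.trans hβ) (φ s) (inclusion hαβ.le (u s)) :
        C0Holder (n + 1) α E E) x -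
      (∫ s in Set.Iic t, compRight (hαβ.le.trans hβ) (ψ s) (inclusion hαβ.le (u s)) :
        C0Holder (n + 1) α E E) x‖ ≤ (∫ s in J, ‖u s‖) * δ := by
  rw [← evalCLM_apply, ← evalCLM_apply,
    ← (evalCLM (n + 1) α E x).integral_comp_comm hφ.integrableOn,
    ← (evalCLM (n + 1) α E x).integral_comp_comm hψ.integrableOn, ← integral_sub
    ((evalCLM (n + 1) α E x).integrable_comp hφ.integrableOn)
    ((evalCLM (n + 1) α E x).integrable_comp hψ.integrableOn), ← integral_mul_const,
    ← integral_indicator hJ]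
  have hi : Integrable (J.indicator fun s => ‖u s‖ * δ) := (hu.norm.mul_const δ).indicator hJ
  refine (norm_integral_le_of_norm_le hi.integrableOn (μ := volume.restrict (Set.Iic t)) ?_).trans
    (setIntegral_le_integral hi (Eventually.of_forall fun s =>
      Set.indicator_nonneg (fun s _ => by positivity) s))
  filter_upwards [ae_restrict_mem measurableSet_Iic] with s hs
  simp only [evalCLM_apply, compRight_apply, inclusion_apply]
  by_cases hsJ : s ∈ J
  · rw [Set.indicator_of_mem hsJ]
    refine ((u s).holderBounded.norm_sub_le _ _).trans ?_
    rw [add_sub_add_left_eq_sub]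
    gcongr
    exact h s hsJ
  · rw [h' s hs hsJ, sub_self, norm_zero, Set.indicator_of_notMem hsJ]

/-- The limit of a Picard iteration in a ball of `C^{n+1,β}_0` is a flow in `C^{n+1,α}_0`. -/
lemma exists_isFlow_of_picard (hαβ : α < β) (hβ : β ≤ 1) {R : ℝ} (hR : 0 ≤ R)
    {u : I → C0Holder (n + 1) β E E} (hu : Integrable u) {Φ : ℕ → C(I, C0Holder (n + 1) α E E)}
    (hb : ∀ k t, HolderBounded (n + 1) β (Φ k t) R)
    (hΦ : ∀ k t, Φ (k + 1) t =
      ∫ s in Set.Iic t, compRight (hαβ.le.trans hβ) (Φ k s) (inclusion hαβ.le (u s)))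
    {r : ℕ → ℝ} (hr : Tendsto r atTop (𝓝 0))
    (hdist : ∀ k m t x, ‖Φ (k + m) t x - Φ k t x‖ ≤ r k) :
    ∃ φ : I → C0Holder (n + 1) α E E, IsFlow hαβ hβ u φ ∧
      ∀ t, HolderBounded (n + 1) β (φ t) R := by
  obtain ⟨c, hc, hcomp⟩ := HolderBounded.comp_id_add_succ (E := E) hβ n R
  have hcauchy : CauchySeq Φ := by
    rw [Metric.cauchySeq_iff']
    intro ε hε
    -- Differences of iterates have `β`-bound `R + R`, so uniform Cauchy estimates become Cauchy
    -- estimates in `C^{n+1,α}_0`.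
    obtain ⟨δ, hδ, hint⟩ := HolderBounded.interpolation (E := E) (n := n + 1) hαβ hβ
      (add_nonneg hR hR) (half_pos hε)
    obtain ⟨N, hN⟩ := (hr.eventually_lt_const hδ).exists
    refine ⟨N, fun k hk => lt_of_le_of_lt ?_ (half_lt_self hε)⟩
    obtain ⟨m, rfl⟩ := Nat.exists_eq_add_of_le hk
    rw [ContinuousMap.dist_le (half_pos hε).le]
    intro t
    rw [dist_eq_norm]
    refine norm_le_of_holderBounded (hint E _ ((hb (N + m) t).sub (hb N t)) fun x => ?_)
    exact (hdist N m t x).trans hN.le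
  obtain ⟨ψ, hψ⟩ := cauchySeq_tendsto_of_complete hcauchy
  have hψt : ∀ t, Tendsto (fun k => Φ k t) atTop (𝓝 (ψ t)) := fun t =>
    ((continuous_eval_const t).tendsto ψ).comp hψ
  have hψb : ∀ t, HolderBounded (n + 1) β (ψ t) R :=
    fun t => holderBounded_of_tendsto (hψt t) fun k => hb k t
  refine ⟨ψ, ⟨ψ.continuous, integrable_compRight_inclusion hαβ hβ hu ψ.continuous hψb,
    fun t => ?_⟩, hψb⟩
  refine tendsto_nhds_unique ((hψt t).comp (tendsto_add_atTop_nat 1)) ?_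
  have heq : ((fun k => Φ k t) ∘ fun k => k + 1) = fun k => ∫ s in Set.Iic t,
      compRight (hαβ.le.trans hβ) (Φ k s) (inclusion hαβ.le (u s)) := funext fun k => hΦ k t
  rw [heq]
  refine tendsto_integral_of_dominated_convergence (fun s => 2 * (c * ‖u s‖))
    (fun k => (integrable_compRight_inclusion hαβ hβ hu (Φ k).continuous
      (hb k)).integrableOn.aestronglyMeasurable)
    ((hu.norm.const_mul c).const_mul 2).integrableOn
    (fun k => Eventually.of_forall fun s => norm_le_of_holderBounded
      ((hcomp E _ _ _ (hb k s) (u s).holderBounded).of_exponent_le hαβ.le))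
    (Eventually.of_forall fun s => ?_)
  exact tendsto_compRight_inclusion hαβ hβ tendsto_const_nhds (hψt s) (fun k => hb k s) (hψb s)

lemma exists_isFlow_of_integral_norm_le (hαβ : α < β) (hβ : β ≤ 1) : ∃ ε : ℝ, 0 < ε ∧
    ∀ u : I → C0Holder (n + 1) β E E, Integrable u → ∫ s, ‖u s‖ ≤ ε →
    ∃ φ : I → C0Holder (n + 1) α E E, IsFlow hαβ hβ u φ ∧
      ∀ t, HolderBounded (n + 1) β (φ t) (1 / 2) := by
  obtain ⟨c, hc, hcomp⟩ := HolderBounded.comp_id_add_succ (E := E) hβ n (1 / 2)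
  -- The first entry gives contraction factor `1 / 2` in the sup norm, the second keeps the `β`-ball
  -- of radius `1 / 2` invariant. That radius is below `1`, as positivity of the determinant will
  -- require.
  refine ⟨min (1 / 2) (1 / (2 * (c + 1))), by positivity, fun u hu hsmall => ?_⟩
  have hu1 : ∫ s, ‖u s‖ ≤ 1 / 2 := hsmall.trans (min_le_left _ _)
  have hu2 : c * ∫ s, ‖u s‖ ≤ 1 / 2 := by
    have h1 := hsmall.trans (min_le_right _ _)
    rw [le_div_iff₀ (by positivity)] at h1
    have : 0 ≤ ∫ s, ‖u s‖ := integral_nonneg fun s => norm_nonneg _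
    nlinarith
  have hut : ∀ t, ∫ s in Set.Iic t, ‖u s‖ ≤ ∫ s, ‖u s‖ := fun t =>
    setIntegral_le_integral hu.norm (Eventually.of_forall fun s => norm_nonneg _)
  have hT : ∀ φ : {φ : C(I, C0Holder (n + 1) α E E) //
      ∀ t, HolderBounded (n + 1) β (φ t) (1 / 2)},
      ∃ ψ : {φ : C(I, C0Holder (n + 1) α E E) // ∀ t, HolderBounded (n + 1) β (φ t) (1 / 2)},
      ∀ t, ψ.1 t = ∫ s in Set.Iic t,
        compRight (hαβ.le.trans hβ) (φ.1 s) (inclusion hαβ.le (u s)) := by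
    intro φ
    have hV := integrable_compRight_inclusion hαβ hβ hu φ.1.continuous φ.2
    refine ⟨⟨⟨_, continuous_setIntegral_Iic hV⟩, fun t => ?_⟩, fun t => rfl⟩
    refine (holderBounded_integral hV.integrableOn (hu.norm.const_mul c).integrableOn
      fun s => hcomp E _ _ _ (φ.2 s) (u s).holderBounded).mono ?_
    rw [integral_const_mul]
    exact (mul_le_mul_of_nonneg_left (hut t) hc).trans hu2
  choose T hT using hT
  have h0 : HolderBounded (n + 1) β (0 : C0Holder (n + 1) α E E) (1 / 2) :=
    ((0 : C0Holder (n + 1) β E E).holderBounded).mono (by simp)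
  obtain ⟨Φ, hΦ⟩ : ∃ Φ : ℕ → {φ : C(I, C0Holder (n + 1) α E E) //
      ∀ t, HolderBounded (n + 1) β (φ t) (1 / 2)}, ∀ k, Φ (k + 1) = T (Φ k) :=
    ⟨fun k => T^[k] ⟨0, fun _ => h0⟩, fun k => Function.iterate_succ_apply' T k _⟩
  have hV := fun k => integrable_compRight_inclusion hαβ hβ hu (Φ k).1.continuous (Φ k).2
  refine exists_isFlow_of_picard hαβ hβ (by norm_num) hu (Φ := fun k => (Φ k).1)
    (fun k => (Φ k).2) (fun k t => by rw [hΦ, hT]) (r := fun k => (1 / 2) ^ k)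
    (tendsto_pow_atTop_nhds_zero_of_lt_one (by norm_num) (by norm_num)) fun k m => ?_
  induction k with
  | zero =>
    intro t x
    -- Two points of the ball of radius `1 / 2` are at distance at most `1 = (1 / 2) ^ 0`.
    refine (norm_sub_le_of_le (((Φ (0 + m)).2 t).norm_le x) (((Φ 0).2 t).norm_le x)).trans ?_
    norm_num
  | succ k ih =>
    intro t x
    rw [Nat.add_right_comm, hΦ, hΦ, hT, hT]
    refine (norm_integral_compRight_sub_le hαβ hβ hu (hV (k + m)) (hV k)
      MeasurableSet.univ (fun s _ => ih s x) (fun s _ hs => (hs trivial).elim)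
      (by positivity)).trans ?_
    rw [pow_succ', setIntegral_univ]
    gcongr

end C0Holder

/-! ### Determinants, concatenation of flows and existence -/

lemma ContinuousLinearMap.det_id_add_pos {E : Type*} [NormedAddCommGroup E] [NormedSpace ℝ E]
    [FiniteDimensional ℝ E] {A : E →L[ℝ] E} (hA : ‖A‖ < 1) :
    0 < (ContinuousLinearMap.id ℝ E + A).det := by
  have : CompleteSpace E := FiniteDimensional.complete ℝ E
  -- Along the segment `Id + t • A` the determinant starts at `1`; a zero would contradict
  -- invertibility by the Neumann series.
  by_contra! h
  have hc : Continuous fun t : ℝ => (ContinuousLinearMap.id ℝ E + t • A).det :=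
    ContinuousLinearMap.continuous_det.comp (by fun_prop)
  obtain ⟨t, ht, h0⟩ : (0 : ℝ) ∈ (fun t : ℝ => (ContinuousLinearMap.id ℝ E + t • A).det) ''
      Set.Icc 0 1 := intermediate_value_Icc' zero_le_one hc.continuousOn
    ⟨by simpa using h, by simp [ContinuousLinearMap.det]⟩
  have h1 : ‖-(t • A)‖ < 1 := by
    rw [norm_neg, norm_smul, Real.norm_of_nonneg ht.1]
    exact (mul_le_of_le_one_left (norm_nonneg _) ht.2).trans_lt hA
  have h2 : IsUnit (1 - -(t • A)) := isUnit_one_sub_of_norm_lt_one h1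
  rw [sub_neg_eq_add] at h2
  have h3 : IsUnit (LinearMap.det (ContinuousLinearMap.toLinearMapRingHom (1 + t • A))) :=
    (h2.map ContinuousLinearMap.toLinearMapRingHom).map LinearMap.det
  exact h3.ne_zero h0

lemma setIntegral_Ioc_eq_sub {G : Type*} [NormedAddCommGroup G] [NormedSpace ℝ G] {f : I → G}
    (hf : Integrable f) {a b : I} (hab : a ≤ b) :
    ∫ s in Set.Ioc a b, f s = (∫ s in Set.Iic b, f s) - ∫ s in Set.Iic a, f s := by
  rw [eq_sub_iff_add_eq', ← setIntegral_union (Set.Iic_disjoint_Ioc le_rfl) measurableSet_Ioc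
    hf.integrableOn hf.integrableOn, Set.Iic_union_Ioc_eq_Iic hab]

namespace C0Holder

variable {E : Type w} [NormedAddCommGroup E] [NormedSpace ℝ E] [CompleteSpace E]
  {n : ℕ} {α β : ℝ≥0} {hαβ : α < β} {hβ : β ≤ 1} {u : I → C0Holder (n + 1) β E E}

omit [CompleteSpace E] in
lemma IsFlow.eq_zero_of_le {t₀ : I} {ψ : I → C0Holder (n + 1) α E E}
    (hψ : IsFlow hαβ hβ ((Set.Iic t₀)ᶜ.indicator u) ψ) {t : I} (ht : t ≤ t₀) : ψ t = 0 := by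
  rw [hψ.eq_integral]
  refine setIntegral_eq_zero_of_forall_eq_zero fun s hs => ?_
  have hs' : s ∉ (Set.Iic t₀)ᶜ := Set.notMem_compl_iff.2 (le_trans hs ht)
  rw [Set.indicator_of_notMem hs', map_zero, map_zero]

omit [CompleteSpace E] in
lemma IsFlow.eq_of_le {t₀ : I} {φ : I → C0Holder (n + 1) α E E}
    (hφ : IsFlow hαβ hβ ((Set.Iic t₀).indicator u) φ) {t : I} (ht : t₀ ≤ t) : φ t = φ t₀ := by
  rw [hφ.eq_integral t, hφ.eq_integral t₀]
  refine setIntegral_eq_of_subset_of_forall_sdiff_eq_zero measurableSet_Iic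
    (Set.Iic_subset_Iic.2 ht) fun s hs => ?_
  rw [Set.indicator_of_notMem hs.2, map_zero, map_zero]

/-- This is `(Id + ψ) ∘ (Id + φ)` in the chart. Before `t₀` the second flow is still the identity;
after `t₀` the first one is frozen. -/
lemma IsFlow.concat {t₀ : I} {φ ψ : I → C0Holder (n + 1) α E E}
    (hφ : IsFlow hαβ hβ ((Set.Iic t₀).indicator u) φ)
    (hψ : IsFlow hαβ hβ ((Set.Iic t₀)ᶜ.indicator u) ψ) :
    IsFlow hαβ hβ u fun t => φ t + compRight (hαβ.le.trans hβ) (φ t) (ψ t) := by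
  have hα := hαβ.le.trans hβ
  -- With `φ t₀` in place of `φ t`, the composition is one fixed continuous linear operator and
  -- commutes with the integral.
  have hcomp : (fun t => φ t + compRight hα (φ t) (ψ t)) =
      fun t => φ t + compRight hα (φ t₀) (ψ t) := by
    ext1 t
    rcases le_total t t₀ with ht | ht
    · rw [hψ.eq_zero_of_le ht, map_zero, map_zero]
    · rw [hφ.eq_of_le ht]
  rw [hcomp]
  have key : (fun s => compRight hα (φ s + compRight hα (φ t₀) (ψ s)) (inclusion hαβ.le (u s))) =
      fun s => compRight hα (φ s) (inclusion hαβ.le ((Set.Iic t₀).indicator u s)) +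
        compRight hα (φ t₀) (compRight hα (ψ s)
          (inclusion hαβ.le ((Set.Iic t₀)ᶜ.indicator u s))) := by
    ext s x
    rcases le_or_gt s t₀ with hs | hs
    · rw [Set.indicator_of_mem (show s ∈ Set.Iic t₀ from hs),
        Set.indicator_of_notMem (Set.notMem_compl_iff.2 (show s ∈ Set.Iic t₀ from hs)),
        hψ.eq_zero_of_le hs]
      simp
    · have hs' : s ∉ Set.Iic t₀ := not_le.2 hs
      rw [Set.indicator_of_notMem hs', Set.indicator_of_mem (Set.mem_compl hs'), hφ.eq_of_le hs.le]
      simp [add_assoc]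
  have hint := (compRight hα (φ t₀)).integrable_comp hψ.integrable
  refine ⟨hφ.continuous.add ((compRight hα (φ t₀)).continuous.comp hψ.continuous), ?_, fun t => ?_⟩
  · rw [key]
    exact hφ.integrable.add hint
  · rw [key, integral_add hφ.integrable.integrableOn hint.integrableOn,
      (compRight hα (φ t₀)).integral_comp_comm hψ.integrable.integrableOn, ← hφ.eq_integral,
      ← hψ.eq_integral]

omit [CompleteSpace E] in
lemma hasFDerivAt_id_add (φ : C0Holder (n + 1) α E E) (x : E) :
    HasFDerivAt (fun y => y + φ y) (ContinuousLinearMap.id ℝ E + fderiv ℝ φ x) x :=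
  (hasFDerivAt_id x).add (φ.holderBounded.differentiable x).hasFDerivAt

omit [CompleteSpace E] in
lemma det_fderiv_id_add_compRight_pos (hα : α ≤ 1) {φ ψ : C0Holder (n + 1) α E E}
    (hφ : ∀ x, 0 < (fderiv ℝ (fun y => y + φ y) x).det)
    (hψ : ∀ x, 0 < (fderiv ℝ (fun y => y + ψ y) x).det) (x : E) :
    0 < (fderiv ℝ (fun y => y + (φ + compRight hα φ ψ) y) x).det := by
  have h1 : (fun y => y + (φ + compRight hα φ ψ) y) =
      (fun y => y + ψ y) ∘ fun y => y + φ y := by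
    ext y
    simp [add_assoc]
  rw [h1, fderiv_comp x (hasFDerivAt_id_add ψ _).differentiableAt
    (hasFDerivAt_id_add φ x).differentiableAt]
  have h2 : ∀ A B : E →L[ℝ] E, (A.comp B).det = A.det * B.det := fun A B =>
    LinearMap.det_comp (A : E →ₗ[ℝ] E) (B : E →ₗ[ℝ] E)
  rw [h2]
  exact mul_pos (hψ _) (hφ x)

/-- Intermediate value theorem for the cumulative mass of `‖f‖`, which is continuous. -/
lemma exists_integral_indicator_norm_eq_half {G : Type*} [NormedAddCommGroup G] {f : I → G}
    (hf : Integrable f) : ∃ t : I, ∫ s, ‖(Set.Iic t).indicator f s‖ = (∫ s, ‖f s‖) / 2 ∧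
      ∫ s, ‖(Set.Iic t)ᶜ.indicator f s‖ = (∫ s, ‖f s‖) / 2 := by
  have h0 : 0 ≤ ∫ s, ‖f s‖ := integral_nonneg fun s => norm_nonneg _
  have hI0 : ∫ s in Set.Iic (0 : I), ‖f s‖ = 0 := by
    rw [show Set.Iic (0 : I) = {0} from Set.Iic_bot]
    simp
  have hI1 : ∫ s in Set.Iic (1 : I), ‖f s‖ = ∫ s, ‖f s‖ := by
    rw [show Set.Iic (1 : I) = Set.univ from Set.Iic_top, setIntegral_univ]
  obtain ⟨t, ht⟩ : (∫ s, ‖f s‖) / 2 ∈ Set.range fun t : I => ∫ s in Set.Iic t, ‖f s‖ :=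
    mem_range_of_exists_le_of_exists_ge (continuous_setIntegral_Iic hf.norm)
      ⟨0, by rw [hI0]; positivity⟩ ⟨1, by rw [hI1]; linarith⟩
  replace ht : ∫ s in Set.Iic t, ‖f s‖ = (∫ s, ‖f s‖) / 2 := ht
  simp only [norm_indicator_eq_indicator_norm]
  refine ⟨t, ?_, ?_⟩
  · rw [integral_indicator measurableSet_Iic, ht]
  · rw [integral_indicator measurableSet_Iic.compl, setIntegral_compl measurableSet_Iic hf.norm, ht]
    ring

lemma exists_isFlow [FiniteDimensional ℝ E] (hαβ : α < β) (hβ : β ≤ 1)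
    {u : I → C0Holder (n + 1) β E E} (hu : Integrable u) :
    ∃ φ : I → C0Holder (n + 1) α E E, IsFlow hαβ hβ u φ ∧
      ∀ t x, 0 < (fderiv ℝ (fun y => y + φ t y) x).det := by
  obtain ⟨ε, hε, hloc⟩ := exists_isFlow_of_integral_norm_le (E := E) (n := n) hαβ hβ
  -- After `k` halvings of the mass every piece satisfies the smallness condition; the induction is
  -- on `k`, for all `u` at once.
  obtain ⟨k, hk⟩ := pow_unbounded_of_one_lt ((∫ s, ‖u s‖) / ε) one_lt_two
  rw [div_lt_iff₀ hε] at hk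
  replace hk := hk.le
  induction k generalizing u with
  | zero =>
    obtain ⟨φ, hφ, hb⟩ := hloc u hu (by simpa using hk)
    refine ⟨φ, hφ, fun t x => ?_⟩
    rw [(hasFDerivAt_id_add _ _).fderiv]
    exact ContinuousLinearMap.det_id_add_pos (((hb t).fderiv.norm_le x).trans_lt (by norm_num))
  | succ k ih =>
    obtain ⟨t₀, h1, h2⟩ := exists_integral_indicator_norm_eq_half hu
    have h3 : (∫ s, ‖u s‖) / 2 ≤ 2 ^ k * ε := by rw [pow_succ] at hk; linarith
    obtain ⟨φ, hφ, hφd⟩ := ih (hu.indicator measurableSet_Iic) (h1.trans_le h3)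
    obtain ⟨ψ, hψ, hψd⟩ := ih (hu.indicator measurableSet_Iic.compl) (h2.trans_le h3)
    exact ⟨_, hφ.concat hψ, fun t => det_fderiv_id_add_compRight_pos _ (hφd t) (hψd t)⟩

/-! ### Uniqueness -/

lemma IsFlow.eq {φ ψ : I → C0Holder (n + 1) α E E} (hu : Integrable u)
    (hφ : IsFlow hαβ hβ u φ) (hψ : IsFlow hαβ hβ u ψ) : φ = ψ := by
  ext t x
  have hD : Continuous fun t => φ t x - ψ t x :=
    ((evalCLM (n + 1) α E x).continuous.comp hφ.continuous).sub
      ((evalCLM (n + 1) α E x).continuous.comp hψ.continuous)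
  -- Continuous induction: this set is closed, contains `0`, and can be extended to the right of
  -- each of its points below `1`.
  let S : Set I := {t | ∀ s ≤ t, φ s x = ψ s x}
  have hS : IsClosed S := by
    have h1 : Sᶜ = (⋃ s ∈ {s | φ s x ≠ ψ s x}, Set.Ioi s) ∪ {s | φ s x ≠ ψ s x} := by
      ext r
      simp only [S, Set.mem_compl_iff, Set.mem_ofPred_eq, not_forall, Set.mem_union, Set.mem_iUnion,
        Set.mem_Ioi, exists_prop]
      constructor
      · rintro ⟨s, hs, h⟩
        rcases hs.lt_or_eq with hs | rfl
        · exact Or.inl ⟨s, h, hs⟩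
        · exact Or.inr h
      · rintro (⟨s, h, hs⟩ | h)
        · exact ⟨s, hs.le, h⟩
        · exact ⟨r, le_rfl, h⟩
    have h2 : {s | φ s x ≠ ψ s x} = (fun t => φ t x - ψ t x) ⁻¹' {0}ᶜ := by
      ext s
      simp [sub_eq_zero]
    rw [← isOpen_compl_iff, h1]
    refine (isOpen_biUnion fun s _ => isOpen_Ioi).union ?_
    rw [h2]
    exact isOpen_compl_singleton.preimage hD
  have h0 : ∀ {χ : I → C0Holder (n + 1) α E E}, IsFlow hαβ hβ u χ → χ 0 = 0 := fun hχ => by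
    have : Set.Iic (0 : I) = {0} := Set.Iic_bot
    rw [hχ.eq_integral, this]
    simp
  have hsub : Set.Icc (0 : I) 1 ⊆ S := by
    refine IsClosed.Icc_subset_of_forall_exists_gt (hS.inter isClosed_Icc) (fun s hs => ?_) ?_
    · rw [le_antisymm hs s.2.1, h0 hφ, h0 hψ]
    · rintro T ⟨hTS, hT⟩ y hy
      have hA := (continuous_setIntegral_Iic hu.norm).tendsto T
      have h1 := (hA.mono_left (nhdsWithin_le_nhds (s := Set.Ioi T))).eventually_lt_const
        (lt_add_of_pos_right _ (one_half_pos (α := ℝ)))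
      have : (𝓝[>] T).NeBot := nhdsGT_neBot_of_exists_gt ⟨y, hy⟩
      obtain ⟨r, hr, hrT⟩ := (h1.and (Ioc_mem_nhdsGT hy)).exists
      -- On `[T, r]` the mass of `‖u‖` is below `1 / 2`, so the integral inequality at a maximum
      -- point bounds the maximum by half of itself, and it vanishes.
      obtain ⟨m, hm, hmax⟩ := isCompact_Icc.exists_isMaxOn (Set.nonempty_Icc.2 hrT.1.le)
        hD.norm.continuousOn
      have h2 := norm_integral_compRight_sub_le hαβ hβ hu hφ.integrable hψ.integrable (t := m)
        (x := x) (J := Set.Ioc T r) measurableSet_Ioc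
        (fun s hs => hmax (Set.Ioc_subset_Icc_self hs))
        (fun s hs hsJ => hTS s (not_lt.1 fun h => hsJ ⟨h, hs.trans hm.2⟩)) (norm_nonneg _)
      rw [← hφ.eq_integral, ← hψ.eq_integral, setIntegral_Ioc_eq_sub hu.norm hrT.1.le] at h2
      have h3 : ‖φ m x - ψ m x‖ = 0 := by
        have := norm_nonneg (φ m x - ψ m x)
        nlinarith
      refine ⟨r, fun s hs => ?_, hrT⟩
      rcases le_or_gt s T with h | h
      · exact hTS s h
      · have h4 : ‖φ s x - ψ s x‖ ≤ ‖φ m x - ψ m x‖ := hmax ⟨h.le, hs⟩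
        rw [h3] at h4
        exact sub_eq_zero.1 (norm_le_zero_iff.1 h4)
  exact hsub ⟨t.2.1, t.2.2⟩ t le_rfl

end C0Holder

/-! ### Passage between `𝒟^{n,α}` and its chart -/

lemma IsStrongFlow.isFlow {n d : ℕ} {α β : ℝ≥0} (hαβ : α < β) (hβ : β ≤ 1)
    {u : I → C0Holder (n + 1) β (EuclideanSpace ℝ (Fin d)) (EuclideanSpace ℝ (Fin d))}
    {Φ : I → HolderDiffeo (n + 1) α d} (h : IsStrongFlow u Φ) :
    C0Holder.IsFlow hαβ hβ u fun t => (Φ t).subId := by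
  obtain ⟨h1, h2, h3, h4⟩ := h
  have key : (fun s => C0Holder.compRight (hαβ.le.trans hβ) (Φ s).subId
      (C0Holder.inclusion hαβ.le (u s))) = fun s => C0Holder.mk (fun x => u s (Φ s x)) (h2 s) := by
    ext s x
    simp [HolderDiffeo.subId]
  exact ⟨continuous_induced_dom.comp h1, by rwa [key], fun t => by rw [key]; exact h4 t⟩

lemma HolderDiffeo.subId_injective {n d : ℕ} {α : ℝ≥0} :
    Function.Injective (HolderDiffeo.subId (n := n) (α := α) (d := d)) := by
  intro Φ Ψ h
  have h1 : Φ.toFun = Ψ.toFun := by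
    ext1 x
    have h2 : Φ.subId x = Ψ.subId x := by rw [h]
    simpa [HolderDiffeo.subId] using h2
  cases Φ
  cases Ψ
  congr

/-- The diffeomorphism `Id + φ`. -/
noncomputable def HolderDiffeo.ofSubId {n d : ℕ} {α : ℝ≥0}
    (φ : C0Holder n α (EuclideanSpace ℝ (Fin d)) (EuclideanSpace ℝ (Fin d)))
    (h : ∀ x, 0 < (fderiv ℝ (fun y => y + φ y) x).det) : HolderDiffeo n α d where
  toFun x := x + φ x
  isC0Holder_sub_id := by simpa only [add_sub_cancel_left] using φ.isC0Holder
  det_pos := h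

lemma HolderDiffeo.subId_ofSubId {n d : ℕ} {α : ℝ≥0}
    (φ : C0Holder n α (EuclideanSpace ℝ (Fin d)) (EuclideanSpace ℝ (Fin d)))
    (h : ∀ x, 0 < (fderiv ℝ (fun y => y + φ y) x).det) :
    (HolderDiffeo.ofSubId φ h).subId = φ := by
  ext1 x
  exact add_sub_cancel_left x (φ x)

lemma C0Holder.IsFlow.isStrongFlow {n d : ℕ} {α β : ℝ≥0} {hαβ : α < β} {hβ : β ≤ 1}
    {u : I → C0Holder (n + 1) β (EuclideanSpace ℝ (Fin d)) (EuclideanSpace ℝ (Fin d))}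
    {φ : I → C0Holder (n + 1) α (EuclideanSpace ℝ (Fin d)) (EuclideanSpace ℝ (Fin d))}
    (hφ : C0Holder.IsFlow hαβ hβ u φ)
    (hdet : ∀ t x, 0 < (fderiv ℝ (fun y => y + φ t y) x).det) :
    IsStrongFlow u fun t => HolderDiffeo.ofSubId (φ t) (hdet t) := by
  refine ⟨continuous_induced_rng.2 ?_, fun s => (C0Holder.compRight (hαβ.le.trans hβ) (φ s)
    (C0Holder.inclusion hαβ.le (u s))).isC0Holder, hφ.integrable, fun t => ?_⟩
  · exact hφ.continuous.congr fun t => (HolderDiffeo.subId_ofSubId (φ t) (hdet t)).symm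
  · rw [HolderDiffeo.subId_ofSubId]
    exact hφ.eq_integral t

theorem mainTheorem7 (d n : ℕ) (hn : 1 ≤ n) (α β : ℝ≥0) (hα : 0 < α) (hαβ : α < β) (hβ : β ≤ 1)
    (u : I → C0Holder n β (EuclideanSpace ℝ (Fin d)) (EuclideanSpace ℝ (Fin d)))
    (hu : Integrable u) :
    ∃! Φ : I → HolderDiffeo n α d, IsStrongFlow u Φ := by
  obtain ⟨n, rfl⟩ := Nat.exists_eq_add_of_le' hn
  obtain ⟨φ, hφ, hdet⟩ := C0Holder.exists_isFlow hαβ hβ hu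
  refine ⟨_, hφ.isStrongFlow hdet, fun Ψ hΨ => ?_⟩
  have h := C0Holder.IsFlow.eq hu (hΨ.isFlow hαβ hβ) hφ
  ext1 t
  exact HolderDiffeo.subId_injective
    ((congrFun h t).trans (HolderDiffeo.subId_ofSubId (φ t) (hdet t)).symm)
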